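/- Let $X=(X_t)_{t\ge 0}$ be a real Lévy process (independent and stationary increments, $X_0=0$ and càdlàg paths almost surely) with generating triplet $(\gamma,b^2,\nu)$, i.e. $\gamma\in\mathbb R$, $b\ge 0$, $\nu$ is a measure on $\mathbb R$ with $\nu(\{0\})=0$ and $\int \min(1,x^2)\,\nu(dx)<\infty$, and $$\mathbb E e^{iuX_t}=\exp\Big\{t\Big(i\gamma u-\frac{b^2u^2}{2}+\int_{\mathbb R}\big(e^{iux}-1-iux\mathbf 1_{|x|\le 1}\big)\nu(dx)\Big)\Big\},\qquad t\ge 0,\ u\in\mathbb R .$$ Let $bB$ be the Brownian component of $X$: if $b>0$, $B$ is a standard Brownian motion such that the processes $B$ and $X-bB$ are independent (if $b=0$, the term $bB$ is zero). For $0<\epsilon\le 1$ and $t\ge 0$ put $$X^\epsilon_t=\gamma t+bB_t+\sum_{0\le s\le t}\Delta X_s\mathbf 1_{\{|\Delta X_s|>\epsilon\}}-t\int_{\epsilon<|x|\le 1}x\,\nu(dx),\qquad R^\epsilon_t=X_t-X^\epsilon_t,$$ where $\Delta X_s=X_s-X_{s-}$ and $\Delta X_0=0$, and $$\sigma(\epsilon)=\Big(\int_{|x|\le\epsilon}x^2\,\nu(dx)\Big)^{1/2},\qquad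 \sigma_0(\epsilon)=\max(\sigma(\epsilon),\epsilon).$$ Then, for all $t\ge 0$ and $0<\epsilon\le 1$, $|R^\epsilon_t|^4$ is integrable and $$\mathbb E|R^\epsilon_t|^4=t\int_{|x|\le\epsilon}x^4\,\nu(dx)+3\big(t\sigma(\epsilon)^2\big)^2 .$$ Moreover, for every real $q>0$ and every $t\ge 0$ there is a constant $K_{q,t}>0$, depending only on $q$ and $t$ (not on $X$, its triplet, or $\epsilon$), such that $|R^\epsilon_t|^q$ is integrable and $$\mathbb E|R^\epsilon_t|^q\le K_{q,t}\,\sigma_0(\epsilon)^q\qquad\text{for all }0<\epsilon\le 1 .$$ -/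

import Mathlib

open MeasureTheory ProbabilityTheory Filter
open scoped NNReal Topology

universe u

namespace SmallJumps

/-- A path `x : [0, ∞) → ℝ` is càdlàg: right-continuous with left limits. -/
def IsCadlag (x : ℝ≥0 → ℝ) : Prop :=
  ∀ t, ContinuousWithinAt x (Set.Ici t) t ∧ ∃ l, Tendsto x (𝓝[<] t) (𝓝 l)

/-- The jump `Δx_s = x_s - x_{s-}` of a path; at `s = 0` Mathlib's left limit is `x 0`,
so `Δx_0 = 0`. -/
noncomputable def jump (x : ℝ≥0 → ℝ) (s : ℝ≥0) : ℝ :=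
  x s - Function.leftLim x s

/-- A real Lévy process: starts from `0`, has independent and stationary increments and, almost
surely, càdlàg paths. -/
structure IsLevyProcess {Ω : Type*} [MeasurableSpace Ω] (P : Measure Ω) (X : ℝ≥0 → Ω → ℝ) :
    Prop where
  measurable : ∀ t, Measurable (X t)
  zero : ∀ᵐ ω ∂P, X 0 ω = 0
  indep : HasIndepIncrements X P
  stationary : ∀ s h : ℝ≥0, IdentDistrib (fun ω => X (s + h) ω - X s ω) (X h) P P
  cadlag : ∀ᵐ ω ∂P, IsCadlag (fun t => X t ω)

/-- A Lévy measure on `ℝ`: no mass at `0` and `∫ min(1, x²) ν(dx) < ∞`. -/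
structure IsLevyMeasure (ν : Measure ℝ) : Prop where
  zero : ν {0} = 0
  integrable : Integrable (fun x : ℝ => min 1 (x ^ 2)) ν

/-- `X` has generating triplet `(γ, b², ν)` (with truncation function `1_{|x| ≤ 1}`): `ν` is a
Lévy measure and the characteristic function of every `X t` is given by the
Lévy–Khintchine formula. -/
structure HasTriplet {Ω : Type*} [MeasurableSpace Ω] (P : Measure Ω) (X : ℝ≥0 → Ω → ℝ)
    (γ b : ℝ) (ν : Measure ℝ) : Prop where
  levyMeasure : IsLevyMeasure ν
  charFun_eq : ∀ (t : ℝ≥0) (u : ℝ),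
    ∫ ω, Complex.exp (Complex.I * u * X t ω) ∂P =
      Complex.exp (t * (Complex.I * γ * u - (b : ℂ) ^ 2 * u ^ 2 / 2 +
        ∫ x : ℝ, (Complex.exp (Complex.I * u * x) - 1 -
          Complex.I * u * Set.indicator {y : ℝ | |y| ≤ 1} (fun y => (y : ℂ)) x) ∂ν))

/-- `b B` is the Brownian component of `X`: `B` is a standard Brownian motion such that `X` is the
independent sum of `b B` and a remaining process. If `b = 0` there is no Brownian component and
`B` is irrelevant. -/
def IsBrownianComponent {Ω : Type*} [MeasurableSpace Ω] (P : Measure Ω) (X : ℝ≥0 → Ω → ℝ)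
    (b : ℝ) (B : ℝ≥0 → Ω → ℝ) : Prop :=
  b ≠ 0 → IsBrownianReal B P ∧
    IndepFun (fun ω (s : ℝ≥0) => B s ω) (fun ω (s : ℝ≥0) => X s ω - b * B s ω) P

/-- The process `X^ε`: drift, Brownian component and the jumps exceeding `ε` in absolute value,
compensated on `ε < |x| ≤ 1`. For a càdlàg path the sum has finitely many terms. -/
noncomputable def truncated {Ω : Type*} (X : ℝ≥0 → Ω → ℝ) (γ b : ℝ) (B : ℝ≥0 → Ω → ℝ)
    (ν : Measure ℝ) (ε : ℝ) (t : ℝ≥0) (ω : Ω) : ℝ :=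
  γ * t + b * B t ω
    + (∑ᶠ s ∈ {s : ℝ≥0 | s ≤ t ∧ ε < |jump (fun r => X r ω) s|}, jump (fun r => X r ω) s)
    - t * ∫ x in {x : ℝ | ε < |x| ∧ |x| ≤ 1}, x ∂ν

/-- The remainder `R^ε = X - X^ε`. -/
noncomputable def remainder {Ω : Type*} (X : ℝ≥0 → Ω → ℝ) (γ b : ℝ) (B : ℝ≥0 → Ω → ℝ)
    (ν : Measure ℝ) (ε : ℝ) (t : ℝ≥0) (ω : Ω) : ℝ :=
  X t ω - truncated X γ b B ν ε t ω

/-- `σ(ε) = (∫_{|x| ≤ ε} x² ν(dx))^{1/2}`. -/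
noncomputable def sigma (ν : Measure ℝ) (ε : ℝ) : ℝ :=
  √(∫ x in {x : ℝ | |x| ≤ ε}, x ^ 2 ∂ν)

/-- `σ₀(ε) = max(σ(ε), ε)`. -/
noncomputable def sigma0 (ν : Measure ℝ) (ε : ℝ) : ℝ :=
  max (sigma ν ε) ε

end SmallJumps

namespace SmallJumps

/-! The Lévy–Itô decomposition is bypassed: the law of the remainder `R` is found directly from its
Laplace transform, `E exp(l R) = exp(t ψ(l))` with `ψ(l) = ∫_{|x| ≤ ε} (exp(l x) - 1 - l x) ν(dx)`
(`mgf_remainder`). The fourth derivative at `0` gives the fourth moment. For `|l| = 1 / σ₀(ε)` one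
has `|l x| ≤ 1` where `|x| ≤ ε`, so `ψ(l) ≤ σ(ε)² / σ₀(ε)² ≤ 1`; the exponential moments are then at
most `exp t`, and they dominate `|R|^q` up to a multiple of `σ₀(ε)^q`.

To reach the Laplace transform, let `g` be bounded and continuous with `g x = x` on `[-ε, ε]`. The
sums of `g` over the increments of `X` along finer and finer grids converge pathwise to `X_t - ∑ (ΔX
- g(ΔX))` (`IsCadlag.tendsto_sum_increments`). Their moment generating functions are `n`-th powers
of that of `g` under the law `p n` of `X_{t/n}`, so it remains to see that `n p n` converges to `t
ν` on functions of second order at `0`. After weighting by `1 - sin x / x`, characteristic functions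
become averaged second differences of the Lévy exponent, and the continuity theorem applies
(`IsInfinitesimalArray.tendsto_integral_mul_sincDefect`). The first-order part is tested by `sin`,
the imaginary part of the characteristic function. Letting `g` tend to `x 1_{|x| ≤ ε}` gives
`IsLevyProcess.mgf_sub_large_jumps`.

Finally, the path of `B` is continuous, so `R` is a functional of `X - b B` alone, hence independent
of `b B`, whose Gaussian factor can be divided out. -/

/-! ### Jumps and oscillation of càdlàg paths. -/

theorem IsCadlag.tendsto_leftLim {x : ℝ≥0 → ℝ} (hx : IsCadlag x) (s : ℝ≥0) :
    Tendsto x (𝓝[<] s) (𝓝 (Function.leftLim x s)) :=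
  tendsto_leftLim_of_tendsto (hx s).2

theorem jump_eq_zero_of_eq_bot {x : ℝ≥0 → ℝ} {s : ℝ≥0} (h : (𝓝[<] s) = ⊥) : jump x s = 0 := by
  rw [jump, leftLim_eq_of_eq_bot x h, sub_self]

theorem jump_zero (x : ℝ≥0 → ℝ) : jump x 0 = 0 := by
  apply jump_eq_zero_of_eq_bot
  simp

theorem IsCadlag.eventually_near {x : ℝ≥0 → ℝ} (hx : IsCadlag x) (s : ℝ≥0) {η : ℝ} (hη : 0 < η) :
    ∀ᶠ u in 𝓝 s, (u < s → |x u - Function.leftLim x s| < η) ∧ (s ≤ u → |x u - x s| < η) := by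
  have h1 := (Metric.tendsto_nhds.1 (hx.tendsto_leftLim s)) η hη
  have h2 := (Metric.tendsto_nhds.1 (hx s).1) η hη
  rw [eventually_nhdsWithin_iff] at h1 h2
  filter_upwards [h1, h2] with u hu1 hu2
  exact ⟨fun h => hu1 h, fun h => hu2 h⟩

theorem IsCadlag.abs_jump_le_of_tendsto {x : ℝ≥0 → ℝ} (hx : IsCadlag x) {r : ℝ≥0} {a η : ℝ}
    (hη : 0 < η) (h1 : |x r - a| ≤ η) (h2 : ∀ᶠ u in 𝓝[<] r, |x u - a| ≤ η) :
    |jump x r| ≤ 2 * η := by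
  rcases eq_or_neBot (𝓝[<] r) with h | h
  · rw [jump_eq_zero_of_eq_bot h]; simp; linarith
  · have h3 : |Function.leftLim x r - a| ≤ η :=
      le_of_tendsto ((hx.tendsto_leftLim r).sub_const a).abs h2
    rw [jump]
    rw [abs_le] at *
    constructor <;> linarith [h1.1, h1.2, h3.1, h3.2]

/-- Compactness of `[0, t]`: every `s` has a neighbourhood in which the path stays within `η / 2` of
the left limit before `s` and within `η / 2` of `x s` after it, so only `s` itself can carry a jump
larger than `η`. -/
theorem IsCadlag.finite_jumps {x : ℝ≥0 → ℝ} (hx : IsCadlag x) (t : ℝ≥0) {η : ℝ} (hη : 0 < η) :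
    {s : ℝ≥0 | s ≤ t ∧ η < |jump x s|}.Finite := by
  set S := {s : ℝ≥0 | s ≤ t ∧ η < |jump x s|} with hS
  have key : (Set.Icc 0 t ∩ S).Finite := by
    refine (isCompact_Icc (a := (0 : ℝ≥0)) (b := t)).induction_on
      (p := fun A => (A ∩ S).Finite) ?_ ?_ ?_ ?_
    · simp
    · intro A B hAB hB
      exact hB.subset (Set.inter_subset_inter_left _ hAB)
    · intro A B hA hB
      rw [Set.union_inter_distrib_right]
      exact hA.union hB
    · intro s _
      obtain ⟨U, hU, hUo, hsU⟩ := eventually_nhds_iff.1 (hx.eventually_near s (half_pos hη))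
      refine ⟨U, mem_nhdsWithin_of_mem_nhds (hUo.mem_nhds hsU), ?_⟩
      refine (Set.finite_singleton s).subset ?_
      rintro r ⟨hrU, hrS⟩
      by_contra hne
      have hev : ∀ᶠ u in 𝓝[<] r, u ∈ U := mem_nhdsWithin_of_mem_nhds (hUo.mem_nhds hrU)
      have hle : |jump x r| ≤ 2 * (η / 2) := by
        rcases lt_or_gt_of_ne hne with h | h
        · refine hx.abs_jump_le_of_tendsto (half_pos hη) (a := Function.leftLim x s)
            ((hU r hrU).1 h).le ?_
          filter_upwards [hev, self_mem_nhdsWithin] with u hu hur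
          exact ((hU u hu).1 (lt_trans hur h)).le
        · refine hx.abs_jump_le_of_tendsto (half_pos hη) (a := x s)
            ((hU r hrU).2 h.le).le ?_
          filter_upwards [hev, mem_nhdsWithin_of_mem_nhds (Ioi_mem_nhds h)] with u hu hur
          exact ((hU u hu).2 (le_of_lt hur)).le
      have := hrS.2
      linarith
  refine key.subset fun s hs => ⟨⟨zero_le, hs.1⟩, hs⟩

/-- Away from the jumps of size more than `η`, a càdlàg path oscillates by at most `2 η` on short
intervals. -/
theorem IsCadlag.exists_small_oscillation {x : ℝ≥0 → ℝ} (hx : IsCadlag x) (t : ℝ≥0) {η : ℝ}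
    (hη : 0 < η) :
    ∃ δ > 0, ∀ u v : ℝ≥0, u ≤ v → v ≤ t → dist v u < δ →
      (∀ s, u < s → s ≤ v → |jump x s| ≤ η) → |x v - x u| ≤ 2 * η := by
  have h := fun s => eventually_nhds_iff.1 (hx.eventually_near s (half_pos hη))
  choose U hU hUo hsU using h
  -- The Lebesgue number places `u` and `v` in a common `U s`. If `u < s ≤ v`, the difference is two
  -- errors of `η / 2` plus the jump at `s`; otherwise only the two errors occur.
  obtain ⟨δ, hδ, hball⟩ := lebesgue_number_lemma_of_metric
    (isCompact_Icc (a := (0 : ℝ≥0)) (b := t)) hUo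
    (fun s _ => Set.mem_iUnion.2 ⟨s, hsU s⟩)
  refine ⟨δ, hδ, fun u v huv hvt hd hj => ?_⟩
  obtain ⟨s, hs⟩ := hball u ⟨zero_le, huv.trans hvt⟩
  have hu := hU s u (hs (Metric.mem_ball_self hδ))
  have hv := hU s v (hs hd)
  rcases le_or_gt s u with h1 | h1
  · have a := abs_lt.1 (hu.2 h1)
    have b := abs_lt.1 (hv.2 (h1.trans huv))
    rw [abs_le]; constructor <;> linarith [a.1, a.2, b.1, b.2]
  · rcases le_or_gt s v with h2 | h2
    · have a := abs_lt.1 (hu.1 h1)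
      have b := abs_lt.1 (hv.2 h2)
      have c := abs_le.1 (hj s h1 h2)
      rw [jump] at c
      rw [abs_le]; constructor <;> linarith [a.1, a.2, b.1, b.2, c.1, c.2]
    · have a := abs_lt.1 (hu.1 h1)
      have b := abs_lt.1 (hv.1 h2)
      rw [abs_le]; constructor <;> linarith [a.1, a.2, b.1, b.2]

/-! ### Grid sums of increments converge to sums over jumps. -/

/-- The `k`-th point of the partition of `[0, t]` into `n` intervals of equal length. -/
noncomputable def gridPoint (t : ℝ≥0) (n k : ℕ) : ℝ≥0 := t * k / n

/-- The index of the interval `(t k / n, t (k + 1) / n]` that contains `s`. -/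
noncomputable def gridIndex (t : ℝ≥0) (n : ℕ) (s : ℝ≥0) : ℕ := ⌈n * s / t⌉₊ - 1

theorem gridPoint_monotone (t : ℝ≥0) (n : ℕ) : Monotone (gridPoint t n) := by
  intro i j hij
  unfold gridPoint
  gcongr

theorem gridPoint_succ (t : ℝ≥0) (n k : ℕ) : gridPoint t n (k + 1) = gridPoint t n k + t / n := by
  unfold gridPoint
  push_cast
  rw [mul_add, add_div, mul_one]

theorem gridPoint_zero (t : ℝ≥0) (n : ℕ) : gridPoint t n 0 = 0 := by simp [gridPoint]

theorem gridPoint_self (t : ℝ≥0) {n : ℕ} (hn : n ≠ 0) : gridPoint t n n = t := by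
  simp [gridPoint, hn]

theorem gridPoint_le (t : ℝ≥0) {n k : ℕ} (hk : k ≤ n) : gridPoint t n k ≤ t := by
  rcases eq_or_ne n 0 with rfl | hn
  · simp [gridPoint]
  · exact (gridPoint_monotone t n hk).trans (gridPoint_self t hn).le

theorem gridPoint_lt_iff {t : ℝ≥0} (ht : 0 < t) {n : ℕ} (hn : n ≠ 0) {k : ℕ} {s : ℝ≥0} :
    gridPoint t n k < s ↔ k < ⌈n * s / t⌉₊ := by
  have hn' : (0 : ℝ≥0) < n := by positivity
  rw [Nat.lt_ceil, gridPoint, div_lt_iff₀ hn', lt_div_iff₀ ht, mul_comm t, mul_comm s]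

theorem gridPoint_gridIndex_lt {t s : ℝ≥0} (ht : 0 < t) {n : ℕ} (hn : n ≠ 0) (hs : 0 < s) :
    gridPoint t n (gridIndex t n s) < s := by
  rw [gridPoint_lt_iff ht hn, gridIndex]
  -- For `s > 0` the truncated subtraction in `gridIndex` is a true one.
  have : 0 < ⌈n * s / t⌉₊ := Nat.ceil_pos.2 (by positivity)
  omega

theorem le_gridPoint_gridIndex_succ {t s : ℝ≥0} (ht : 0 < t) {n : ℕ} (hn : n ≠ 0) :
    s ≤ gridPoint t n (gridIndex t n s + 1) := by
  rw [← not_lt, gridPoint_lt_iff ht hn, gridIndex]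
  omega

theorem gridIndex_eq {t s : ℝ≥0} (ht : 0 < t) {n k : ℕ} (hn : n ≠ 0)
    (h1 : gridPoint t n k < s) (h2 : s ≤ gridPoint t n (k + 1)) : gridIndex t n s = k := by
  rw [gridPoint_lt_iff ht hn] at h1
  rw [← not_lt, gridPoint_lt_iff ht hn] at h2
  rw [gridIndex]
  omega

theorem gridIndex_lt {t s : ℝ≥0} (ht : 0 < t) {n : ℕ} (hn : n ≠ 0) (hs : 0 < s) (hst : s ≤ t) :
    gridIndex t n s < n := by
  have h := gridPoint_gridIndex_lt ht hn hs
  by_contra hcon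
  have := gridPoint_monotone t n (not_lt.1 hcon)
  rw [gridPoint_self t hn] at this
  exact absurd (h.trans_le hst) (not_lt.2 this)

theorem tendsto_mesh (t : ℝ≥0) : Tendsto (fun n : ℕ => t / n) atTop (𝓝 0) :=
  tendsto_const_div_atTop_nhds_zero_nat t

/-- Grid intervals are open on the left and closed on the right. The left endpoint tends to `s`
strictly from below, where the path has its left limit, and the right endpoint from above, where the
path is right-continuous; so the increment tends to the jump. -/
theorem tendsto_gridPoint_gridIndex {t s : ℝ≥0} (ht : 0 < t) (hs : 0 < s) :
    Tendsto (fun n => gridPoint t n (gridIndex t n s)) atTop (𝓝[<] s) := by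
  refine tendsto_nhdsWithin_iff.2 ⟨?_, ?_⟩
  · have h1 : Tendsto (fun n : ℕ => s - t / n) atTop (𝓝 s) := by
      simpa using (tendsto_const_nhds (x := s)).sub (tendsto_mesh t)
    refine tendsto_of_tendsto_of_tendsto_of_le_of_le' h1 tendsto_const_nhds ?_ ?_
    · filter_upwards [eventually_ne_atTop 0] with n hn
      have := le_gridPoint_gridIndex_succ (s := s) ht hn
      rw [gridPoint_succ] at this
      exact tsub_le_iff_right.2 this
    · filter_upwards [eventually_ne_atTop 0] with n hn
      exact (gridPoint_gridIndex_lt ht hn hs).le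
  · filter_upwards [eventually_ne_atTop 0] with n hn
    exact gridPoint_gridIndex_lt ht hn hs

theorem tendsto_gridPoint_gridIndex_succ {t s : ℝ≥0} (ht : 0 < t) (hs : 0 < s) :
    Tendsto (fun n => gridPoint t n (gridIndex t n s + 1)) atTop (𝓝[≥] s) := by
  refine tendsto_nhdsWithin_iff.2 ⟨?_, ?_⟩
  · simp_rw [gridPoint_succ]
    simpa using ((tendsto_gridPoint_gridIndex ht hs).mono_right nhdsWithin_le_nhds).add
      (tendsto_mesh t)
  · filter_upwards [eventually_ne_atTop 0] with n hn
    exact le_gridPoint_gridIndex_succ ht hn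

/-- For `s < r` the left endpoint of the interval of `r` eventually exceeds `s`, so distinct jump
times fall in distinct intervals. -/
theorem eventually_gridIndex_injOn {t : ℝ≥0} (ht : 0 < t) {J : Set ℝ≥0} (hJ : J.Finite)
    (hpos : ∀ s ∈ J, 0 < s) : ∀ᶠ n in atTop, Set.InjOn (gridIndex t n) J := by
  have : ∀ s ∈ J, ∀ r ∈ J, ∀ᶠ n in atTop, gridIndex t n s = gridIndex t n r → s = r := by
    intro s hs r hr
    by_cases h : s = r
    · exact Eventually.of_forall fun _ _ => h
    wlog hlt : s < r generalizing s r
    · filter_upwards [this r hr s hs (Ne.symm h) (lt_of_le_of_ne (not_lt.1 hlt) (Ne.symm h))]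
        with n hn heq using (hn heq.symm).symm
    filter_upwards [((tendsto_gridPoint_gridIndex ht (hpos r hr)).mono_right
      nhdsWithin_le_nhds).eventually (lt_mem_nhds hlt),
      ((tendsto_gridPoint_gridIndex ht (hpos s hs))).eventually self_mem_nhdsWithin]
      with n h1 h2 heq
    rw [← heq] at h1
    exact absurd (h1.trans h2) (lt_irrefl _)
  have h2 := (hJ.eventually_all).2 fun s hs => (hJ.eventually_all).2 (this s hs)
  filter_upwards [h2] with n hn s hs r hr using hn s hs r hr

/-- The sums of a function that vanishes on `[-ε, ε]` over the increments of a càdlàg path along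
the grids converge to its sum over the jumps. -/
theorem IsCadlag.tendsto_sum_increments {x : ℝ≥0 → ℝ} (hx : IsCadlag x) (t : ℝ≥0) {ε : ℝ}
    (hε : 0 < ε) {f : ℝ → ℝ} (hf : Continuous f) (hf0 : ∀ y, |y| ≤ ε → f y = 0) :
    Tendsto (fun n : ℕ => ∑ k ∈ Finset.range n,
        f (x (gridPoint t n (k + 1)) - x (gridPoint t n k))) atTop
      (𝓝 (∑ᶠ s ∈ {s : ℝ≥0 | s ≤ t ∧ ε < |jump x s|}, f (jump x s))) := by
  -- The threshold is `ε / 2`, not `ε`: an interval free of such jumps has an increment of at most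
  -- `2 * (ε / 2)`, where `f` vanishes. The extra jumps, in `(ε / 2, ε]`, contribute zero.
  have hfin := hx.finite_jumps t (half_pos hε)
  have hsub : {s : ℝ≥0 | s ≤ t ∧ ε < |jump x s|} ⊆ {s : ℝ≥0 | s ≤ t ∧ ε / 2 < |jump x s|} :=
    fun s hs => ⟨hs.1, by linarith [hs.2]⟩
  have hlim : ∑ᶠ s ∈ {s : ℝ≥0 | s ≤ t ∧ ε < |jump x s|}, f (jump x s)
      = ∑ s ∈ hfin.toFinset, f (jump x s) := by
    rw [finsum_mem_eq_finite_toFinset_sum _ (hfin.subset hsub)]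
    refine Finset.sum_subset (by simpa using hsub) fun s hs hs' => ?_
    apply hf0
    simp only [Set.Finite.mem_toFinset, Set.mem_ofPred_eq, not_and, not_lt] at hs hs'
    exact hs' hs.1
  rw [hlim]
  rcases eq_or_lt_of_le (zero_le (a := t)) with rfl | ht
  · have h0 : ∀ n k, gridPoint 0 n k = 0 := fun n k => by simp [gridPoint]
    have h1 : hfin.toFinset = ∅ := by
      ext s
      simp only [Set.Finite.mem_toFinset, Set.mem_ofPred_eq, Finset.notMem_empty, iff_false]
      rintro ⟨h1, h2⟩
      obtain rfl : s = 0 := le_antisymm h1 zero_le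
      rw [jump_zero] at h2
      simp at h2; linarith
    have h2 : f 0 = 0 := hf0 0 (by simp; linarith)
    have h3 : ∑ s ∈ hfin.toFinset, f (jump x s) = 0 := by rw [h1, Finset.sum_empty]
    rw [h3]
    simp [h0, h2]
  have hpos : ∀ s ∈ {s : ℝ≥0 | s ≤ t ∧ ε / 2 < |jump x s|}, 0 < s := by
    rintro s ⟨_, h2⟩
    rcases eq_or_lt_of_le (zero_le (a := s)) with rfl | h
    · rw [jump_zero] at h2
      simp at h2; linarith
    · exact h
  have hterm : Tendsto (fun n => ∑ s ∈ hfin.toFinset,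
      f (x (gridPoint t n (gridIndex t n s + 1)) - x (gridPoint t n (gridIndex t n s)))) atTop
      (𝓝 (∑ s ∈ hfin.toFinset, f (jump x s))) := by
    refine tendsto_finsetSum _ fun s hs => ?_
    have hs0 := hpos s (by simpa using hs)
    refine (hf.tendsto _).comp (Tendsto.sub ?_ ?_)
    · exact ((hx s).1.tendsto).comp (tendsto_gridPoint_gridIndex_succ ht hs0)
    · exact (hx.tendsto_leftLim s).comp (tendsto_gridPoint_gridIndex ht hs0)
  refine hterm.congr' ?_
  obtain ⟨δ, hδ, hosc⟩ := hx.exists_small_oscillation t (half_pos hε)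
  have hmesh : ∀ᶠ n : ℕ in atTop, dist (t / n) 0 < δ := Metric.tendsto_nhds.1 (tendsto_mesh t) δ hδ
  filter_upwards [eventually_gridIndex_injOn ht hfin hpos, eventually_ne_atTop 0, hmesh]
    with n hinj hn hd
  rw [← Finset.sum_image (s := hfin.toFinset) (g := gridIndex t n)
    (f := fun k => f (x (gridPoint t n (k + 1)) - x (gridPoint t n k)))
    (by simpa using hinj)]
  refine Finset.sum_subset ?_ ?_
  · intro k hk
    obtain ⟨s, hs, rfl⟩ := Finset.mem_image.1 hk
    have hs' : s ∈ {s : ℝ≥0 | s ≤ t ∧ ε / 2 < |jump x s|} := by simpa using hs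
    exact Finset.mem_range.2 (gridIndex_lt ht hn (hpos s hs') hs'.1)
  · intro k hk hk'
    have hkn := Finset.mem_range.1 hk
    apply hf0
    have := hosc (gridPoint t n k) (gridPoint t n (k + 1)) (gridPoint_monotone t n (Nat.le_succ k))
      (gridPoint_le t hkn) ?_ ?_
    · linarith
    · rw [gridPoint_succ]
      rw [NNReal.dist_eq] at hd ⊢
      push_cast at hd ⊢
      simpa using hd
    · intro s h1 h2
      by_contra hcon
      apply hk'
      refine Finset.mem_image.2 ⟨s, ?_, gridIndex_eq ht hn h1 h2⟩
      simp only [Set.Finite.mem_toFinset, Set.mem_ofPred_eq]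
      exact ⟨h2.trans (gridPoint_le t hkn), not_le.1 hcon⟩

/-! ### The continuity theorem for finite measures. -/

/-- Finite measures on `ℝ` whose characteristic functions converge to that of a finite measure
converge weakly. -/
theorem tendsto_integral_of_tendsto_charFun {m : ℕ → Measure ℝ} {m₀ : Measure ℝ}
    [hm : ∀ n, IsFiniteMeasure (m n)] [hm₀ : IsFiniteMeasure m₀]
    (h : ∀ u, Tendsto (fun n => charFun (m n) u) atTop (𝓝 (charFun m₀ u)))
    {H : ℝ → ℝ} (hH : Continuous H) {C : ℝ} (hC : ∀ x, |H x| ≤ C) :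
    Tendsto (fun n => ∫ x, H x ∂(m n)) atTop (𝓝 (∫ x, H x ∂m₀)) := by
  let M : ℕ → FiniteMeasure ℝ := fun n => ⟨m n, hm n⟩
  let M₀ : FiniteMeasure ℝ := ⟨m₀, hm₀⟩
  have hmassR : Tendsto (fun n => ((M n).mass : ℝ)) atTop (𝓝 (M₀.mass : ℝ)) := by
    have h0 := h 0
    simp only [charFun_zero] at h0
    exact (Complex.continuous_re.tendsto _).comp h0
  have hmass : Tendsto (fun n => (M n).mass) atTop (𝓝 M₀.mass) := NNReal.tendsto_coe.1 hmassR
  have hM : Tendsto M atTop (𝓝 M₀) := by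
    -- The masses converge, being values at `0` of the characteristic functions. A zero limit cannot
    -- be normalised to a probability measure, but there the masses alone suffice.
    rcases eq_or_ne M₀ 0 with h0 | h0
    · rw [h0] at hmass ⊢
      apply FiniteMeasure.tendsto_zero_of_tendsto_zero_mass
      simpa using hmass
    · refine FiniteMeasure.tendsto_of_tendsto_normalize_testAgainstNN_of_tendsto_mass ?_ hmass
      refine ProbabilityMeasure.tendsto_of_tendsto_charFun fun u => ?_
      have hne : M₀.mass ≠ 0 := (FiniteMeasure.mass_nonzero_iff _).2 h0
      have hform : ∀ N : FiniteMeasure ℝ, N ≠ 0 →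
          charFun (N.normalize : Measure ℝ) u = (N.mass : ℝ)⁻¹ • charFun (N : Measure ℝ) u := by
        intro N hN
        rw [N.toMeasure_normalize_eq_of_nonzero hN, charFun_apply, charFun_apply,
          integral_smul_nnreal_measure]
        rfl
      rw [hform M₀ h0]
      have hev : ∀ᶠ n in atTop, M n ≠ 0 := by
        filter_upwards [hmass.eventually_ne hne] with n hn
        exact (FiniteMeasure.mass_nonzero_iff _).1 hn
      refine Tendsto.congr' (f₁ := fun n => ((M n).mass : ℝ)⁻¹ • charFun (M n : Measure ℝ) u) ?_ ?_
      · filter_upwards [hev] with n hn using (hform _ hn).symm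
      · exact (hmassR.inv₀ (by exact_mod_cast hne)).smul (h u)
  exact FiniteMeasure.tendsto_iff_forall_integral_tendsto.1 hM
    (BoundedContinuousFunction.ofNormedAddCommGroup H hH C hC)

/-- A measure that integrates `min(1, x²)` and does not charge `0` is σ-finite. -/
theorem IsLevyMeasure.sigmaFinite {ν : Measure ℝ} (hν : IsLevyMeasure ν) : SigmaFinite ν := by
  have hl : Measurable (fun x : ℝ => min 1 (x ^ 2)) := by fun_prop
  have hS : ∀ n : ℕ, ν {x | (1 : ℝ) / (n + 1) ≤ min 1 (x ^ 2)} < ⊤ := fun n => by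
    have := hν.integrable.measure_norm_ge_lt_top (ε := 1 / (n + 1)) (by positivity)
    refine lt_of_le_of_lt (measure_mono fun x hx => ?_) this
    have hx' : (1 : ℝ) / (n + 1) ≤ min 1 (x ^ 2) := hx
    exact hx'.trans (le_abs_self _)
  refine ⟨⟨⟨fun n => {0} ∪ {x | (1 : ℝ) / (n + 1) ≤ min 1 (x ^ 2)}, fun _ => trivial,
    fun n => ?_, ?_⟩⟩⟩
  · refine lt_of_le_of_lt (measure_union_le _ _) ?_
    rw [hν.zero, zero_add]
    exact hS n
  · refine Set.eq_univ_of_forall fun x => Set.mem_iUnion.2 ?_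
    by_cases hx : x = 0
    · exact ⟨0, Or.inl hx⟩
    · have hpos : 0 < min 1 (x ^ 2) := lt_min one_pos (by positivity)
      obtain ⟨n, hn⟩ := exists_nat_one_div_lt hpos
      exact ⟨n, Or.inr hn.le⟩

/-! ### The weight of second order at the origin. -/

/-- The weight `1 - sin x / x = ∫₀¹ (1 - cos (s x)) ds`. -/
noncomputable def sincDefect (x : ℝ) : ℝ := 1 - Real.sinc x

theorem continuous_sincDefect : Continuous sincDefect :=
  continuous_const.sub Real.continuous_sinc

theorem sincDefect_zero : sincDefect 0 = 0 := by simp [sincDefect]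

theorem sincDefect_nonneg (x : ℝ) : 0 ≤ sincDefect x := sub_nonneg.2 (Real.sinc_le_one x)

theorem sincDefect_neg (x : ℝ) : sincDefect (-x) = sincDefect x := by
  simp [sincDefect]

theorem sincDefect_pos {x : ℝ} (hx : x ≠ 0) : 0 < sincDefect x := by
  wlog h : 0 < x generalizing x
  · rw [← sincDefect_neg]
    exact this (neg_ne_zero.2 hx) (by
      rcases lt_or_gt_of_ne hx with h' | h'
      · linarith
      · exact absurd h' h)
  rw [sincDefect, Real.sinc_of_ne_zero hx, sub_pos, div_lt_one h]
  exact Real.sin_lt h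

theorem sincDefect_le (x : ℝ) : sincDefect x ≤ 2 * min 1 (x ^ 2) := by
  rw [mul_min_of_nonneg _ _ (by norm_num)]
  refine le_min (by linarith [Real.neg_one_le_sinc x, show sincDefect x = 1 - Real.sinc x from rfl])
    ?_
  by_cases hx : x = 0
  · simp [hx, sincDefect_zero]
  wlog h : 0 < x generalizing x
  · rw [← sincDefect_neg, ← neg_sq]
    exact this (-x) (neg_ne_zero.2 hx) (by
      rcases lt_or_gt_of_ne hx with h' | h'
      · linarith
      · exact absurd h' h)
  have h1 := Real.sin_gt_sub_cube h
  rw [sincDefect, Real.sinc_of_ne_zero hx]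
  have h2 : 1 - x ^ 2 / 6 ≤ Real.sin x / x := by
    rw [le_div_iff₀ h]; nlinarith
  nlinarith [sq_nonneg x]

theorem half_le_sincDefect {x : ℝ} (hx : 2 ≤ |x|) : 1 / 2 ≤ sincDefect x := by
  have h0 : x ≠ 0 := by rintro rfl; norm_num at hx
  have h := Real.sinc_le_inv_abs h0
  have h2 : |x|⁻¹ ≤ 1 / 2 := by
    rw [one_div]; exact inv_anti₀ (by norm_num) hx
  rw [sincDefect]; linarith

theorem abs_sincDefect_sub_le {x : ℝ} (hx : |x| ≤ 1) : |sincDefect x - x ^ 2 / 6| ≤ x ^ 4 := by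
  by_cases h0 : x = 0
  · simp [h0, sincDefect_zero]
  have h := Real.sin_bound hx
  rw [sincDefect, Real.sinc_of_ne_zero h0]
  have e : 1 - Real.sin x / x - x ^ 2 / 6 = -(Real.sin x - (x - x ^ 3 / 6)) / x := by
    field_simp; ring
  rw [e, abs_div, abs_neg, div_le_iff₀ (abs_pos.2 h0)]
  have e2 : x ^ 4 * |x| = |x| ^ 5 := by
    rw [← (show |x| ^ 4 = x ^ 4 from (by decide : Even 4).pow_abs x)]; ring
  rw [e2]
  have : 0 ≤ |x| ^ 5 := by positivity
  linarith

/-- This formula is the reason for the choice of weight: multiplying a measure by `1 - cos (s x)`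
takes a second difference of its characteristic function (`exp_mul_one_sub_cos`), so the weighted
measures have explicit characteristic functions. -/
theorem sincDefect_eq_integral (x : ℝ) :
    sincDefect x = ∫ s in Set.Ioc (0 : ℝ) 1, (1 - Real.cos (s * x)) := by
  rw [← intervalIntegral.integral_of_le zero_le_one]
  rw [intervalIntegral.integral_sub (by simp) (by
    apply Continuous.intervalIntegrable; fun_prop)]
  by_cases hx : x = 0
  · simp [hx, sincDefect_zero]
  · rw [intervalIntegral.integral_comp_mul_right (fun y => Real.cos y) hx, integral_cos]
    simp [sincDefect, Real.sinc_of_ne_zero hx, div_eq_inv_mul]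

theorem one_sub_cos_le {s x : ℝ} (hs : |s| ≤ 1) : 1 - Real.cos (s * x) ≤ 2 * min 1 (x ^ 2) := by
  rw [mul_min_of_nonneg _ _ (by norm_num)]
  refine le_min (by linarith [Real.neg_one_le_cos (s * x)]) ?_
  have h := Real.one_sub_sq_div_two_le_cos (x := s * x)
  have h2 : s ^ 2 ≤ 1 := by rw [← sq_abs]; nlinarith [abs_nonneg s]
  nlinarith [sq_nonneg x, mul_pow s x 2]

/-- Fubini for `sincDefect x = ∫₀¹ (1 - cos (s x)) ds`. -/
theorem integral_exp_mul_sincDefect {μ : Measure ℝ} [SFinite μ]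
    (hμ : Integrable (fun x : ℝ => min 1 (x ^ 2)) μ) (u : ℝ) :
    ∫ x : ℝ, Complex.exp (u * x * Complex.I) * (sincDefect x : ℂ) ∂μ =
      ∫ s in Set.Ioc (0 : ℝ) 1,
        ∫ x : ℝ, Complex.exp (u * x * Complex.I) * ((1 - Real.cos (s * x) : ℝ) : ℂ) ∂μ := by
  rw [integral_integral_swap]
  · refine integral_congr_ae (Eventually.of_forall fun x => ?_)
    simp only
    rw [integral_const_mul, integral_complex_ofReal, sincDefect_eq_integral]
  · have hd : Integrable (fun p : ℝ × ℝ => 2 * min 1 (p.2 ^ 2))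
        ((volume.restrict (Set.Ioc (0 : ℝ) 1)).prod μ) :=
      (hμ.comp_snd (volume.restrict (Set.Ioc (0 : ℝ) 1))).const_mul 2
    refine hd.mono' ?_ ?_
    · apply Continuous.aestronglyMeasurable
      unfold Function.uncurry
      fun_prop
    · have hs : ∀ᵐ p ∂((volume.restrict (Set.Ioc (0 : ℝ) 1)).prod μ),
          p.1 ∈ Set.Ioc (0 : ℝ) 1 := by
        have := ae_restrict_mem (μ := (volume : Measure ℝ)) (measurableSet_Ioc (a := (0 : ℝ)) (b := 1))
        exact Measure.quasiMeasurePreserving_fst.ae this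
      filter_upwards [hs] with p hp
      simp only [Function.uncurry]
      rw [norm_mul, ← Complex.ofReal_mul, Complex.norm_exp_ofReal_mul_I, one_mul,
        Complex.norm_real, Real.norm_of_nonneg (by linarith [Real.cos_le_one (p.1 * p.2)])]
      exact one_sub_cos_le (abs_le.2 ⟨by linarith [hp.1], hp.2⟩)

theorem exp_mul_one_sub_cos (u s x : ℝ) :
    Complex.exp (u * x * Complex.I) * ((1 - Real.cos (s * x) : ℝ) : ℂ) =
      Complex.exp (u * x * Complex.I) - Complex.exp ((u + s : ℝ) * x * Complex.I) / 2
        - Complex.exp ((u - s : ℝ) * x * Complex.I) / 2 := by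
  push_cast
  rw [Complex.cos, show ((u : ℂ) + s) * x * Complex.I = u * x * Complex.I + s * x * Complex.I by ring,
    show ((u : ℂ) - s) * x * Complex.I = u * x * Complex.I + -(s * x) * Complex.I by ring,
    Complex.exp_add, Complex.exp_add]
  ring

theorem charFun_withDensity_sincDefect (μ : Measure ℝ) (u : ℝ) :
    charFun (μ.withDensity fun x => ENNReal.ofReal (sincDefect x)) u =
      ∫ x : ℝ, Complex.exp (u * x * Complex.I) * (sincDefect x : ℂ) ∂μ := by
  rw [charFun_apply_real, integral_withDensity_eq_integral_toReal_smul
    (continuous_sincDefect.measurable.ennreal_ofReal) (Eventually.of_forall fun _ => by simp)]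
  refine integral_congr_ae (Eventually.of_forall fun x => ?_)
  simp only
  rw [ENNReal.toReal_ofReal (sincDefect_nonneg x), Complex.real_smul, mul_comm]

theorem integral_withDensity_sincDefect (μ : Measure ℝ) (H : ℝ → ℝ) :
    ∫ x, H x ∂(μ.withDensity fun x => ENNReal.ofReal (sincDefect x)) =
      ∫ x : ℝ, H x * sincDefect x ∂μ := by
  rw [integral_withDensity_eq_integral_toReal_smul
    (continuous_sincDefect.measurable.ennreal_ofReal) (Eventually.of_forall fun _ => by simp)]
  refine integral_congr_ae (Eventually.of_forall fun x => ?_)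
  simp only
  rw [ENNReal.toReal_ofReal (sincDefect_nonneg x), smul_eq_mul, mul_comm]

theorem integrable_sincDefect {μ : Measure ℝ}
    (hμ : Integrable (fun x : ℝ => min 1 (x ^ 2)) μ) : Integrable sincDefect μ := by
  refine (hμ.const_mul 2).mono' continuous_sincDefect.aestronglyMeasurable
    (Eventually.of_forall fun x => ?_)
  rw [Real.norm_of_nonneg (sincDefect_nonneg x)]
  exact sincDefect_le x

theorem isFiniteMeasure_withDensity_sincDefect {μ : Measure ℝ}
    (hμ : Integrable (fun x : ℝ => min 1 (x ^ 2)) μ) :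
    IsFiniteMeasure (μ.withDensity fun x => ENNReal.ofReal (sincDefect x)) :=
  isFiniteMeasure_withDensity_ofReal (integrable_sincDefect hμ).2

theorem integrable_min_one_sq (μ : Measure ℝ) [IsFiniteMeasure μ] :
    Integrable (fun x : ℝ => min 1 (x ^ 2)) μ := by
  refine (integrable_const (1 : ℝ)).mono' (by fun_prop) (Eventually.of_forall fun x => ?_)
  rw [Real.norm_of_nonneg (le_min zero_le_one (sq_nonneg x))]
  exact min_le_left _ _

/-! ### The Lévy exponent and its second differences. -/

/-- The integrand of the Lévy–Khintchine formula. -/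
noncomputable def levyKernel (u x : ℝ) : ℂ :=
  Complex.exp (Complex.I * u * x) - 1 -
    Complex.I * u * Set.indicator {y : ℝ | |y| ≤ 1} (fun y => (y : ℂ)) x

/-- The characteristic exponent of the triplet `(γ, b², ν)`. -/
noncomputable def levyExponent (γ b : ℝ) (ν : Measure ℝ) (u : ℝ) : ℂ :=
  Complex.I * γ * u - (b : ℂ) ^ 2 * u ^ 2 / 2 + ∫ x : ℝ, levyKernel u x ∂ν

theorem measurableSet_abs_le (ε : ℝ) : MeasurableSet {y : ℝ | |y| ≤ ε} :=
  (isClosed_le continuous_abs continuous_const).measurableSet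

theorem norm_exp_I_sub_one_sub_le (y : ℝ) :
    ‖Complex.exp (Complex.I * y) - 1 - Complex.I * y‖ ≤ 3 * y ^ 2 := by
  have hn : ‖Complex.I * (y : ℂ)‖ = |y| := by simp
  rcases le_or_gt |y| 1 with h | h
  · have := Complex.norm_exp_sub_one_sub_id_le (x := Complex.I * y) (by rw [hn]; exact h)
    rw [hn, sq_abs] at this
    nlinarith [sq_nonneg y]
  · have h1 : ‖Complex.exp (Complex.I * y) - 1‖ ≤ |y| := Real.norm_exp_I_mul_ofReal_sub_one_le
    calc _ ≤ ‖Complex.exp (Complex.I * y) - 1‖ + ‖Complex.I * (y : ℂ)‖ := norm_sub_le _ _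
      _ ≤ |y| + |y| := by rw [hn]; gcongr
      _ ≤ 3 * y ^ 2 := by rw [← sq_abs]; nlinarith

theorem norm_levyKernel_le (u x : ℝ) : ‖levyKernel u x‖ ≤ (3 * u ^ 2 + 2) * min 1 (x ^ 2) := by
  rw [levyKernel]
  by_cases hx : |x| ≤ 1
  · rw [Set.indicator_of_mem (show x ∈ {y : ℝ | |y| ≤ 1} from hx)]
    have h1 : x ^ 2 ≤ 1 := by rw [← sq_abs]; nlinarith [abs_nonneg x]
    have h2 := norm_exp_I_sub_one_sub_le (u * x)
    push_cast at h2
    rw [min_eq_right h1, mul_assoc]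
    refine h2.trans ?_
    nlinarith [sq_nonneg x]
  · rw [Set.indicator_of_notMem (show x ∉ {y : ℝ | |y| ≤ 1} from hx), mul_zero, sub_zero]
    have h1 : 1 ≤ x ^ 2 := by rw [← sq_abs]; nlinarith [not_le.1 hx]
    rw [min_eq_left h1, mul_one]
    calc _ ≤ ‖Complex.exp (Complex.I * u * x)‖ + ‖(1 : ℂ)‖ := norm_sub_le _ _
      _ = 2 := by
        rw [show Complex.I * u * x = ((u * x : ℝ) : ℂ) * Complex.I by push_cast; ring,
          Complex.norm_exp_ofReal_mul_I]
        norm_num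
      _ ≤ _ := by nlinarith [sq_nonneg u]

theorem measurable_levyKernel (u : ℝ) : Measurable (levyKernel u) := by
  unfold levyKernel
  refine Measurable.sub (by fun_prop) (Measurable.const_mul ?_ _)
  exact Measurable.indicator (by fun_prop) (measurableSet_abs_le 1)

theorem IsLevyMeasure.integrable_levyKernel {ν : Measure ℝ} (hν : IsLevyMeasure ν) (u : ℝ) :
    Integrable (levyKernel u) ν :=
  (hν.integrable.const_mul (3 * u ^ 2 + 2)).mono' (measurable_levyKernel u).aestronglyMeasurable
    (Eventually.of_forall (norm_levyKernel_le u))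

theorem IsLevyMeasure.norm_levyExponent_le {ν : Measure ℝ} (hν : IsLevyMeasure ν) (γ b : ℝ)
    {u r : ℝ} (hu : |u| ≤ r) :
    ‖levyExponent γ b ν u‖ ≤ |γ| * r + b ^ 2 * r ^ 2 / 2
      + (3 * r ^ 2 + 2) * ∫ x : ℝ, min 1 (x ^ 2) ∂ν := by
  have hr : u ^ 2 ≤ r ^ 2 := by rw [← sq_abs]; gcongr
  have h1 : ‖Complex.I * (γ : ℂ) * u‖ ≤ |γ| * r := by
    simp only [norm_mul, Complex.norm_I, Complex.norm_real, one_mul, Real.norm_eq_abs]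
    gcongr
  have h2 : ‖(b : ℂ) ^ 2 * u ^ 2 / 2‖ ≤ b ^ 2 * r ^ 2 / 2 := by
    simp only [norm_mul, norm_div, norm_pow, Complex.norm_real, Real.norm_eq_abs, sq_abs]
    norm_num
    gcongr
  have h3 : ‖∫ x : ℝ, levyKernel u x ∂ν‖ ≤ (3 * r ^ 2 + 2) * ∫ x : ℝ, min 1 (x ^ 2) ∂ν := by
    rw [← integral_const_mul]
    refine norm_integral_le_of_norm_le (hν.integrable.const_mul _) (Eventually.of_forall fun x => ?_)
    refine (norm_levyKernel_le u x).trans ?_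
    have : 0 ≤ min 1 (x ^ 2) := le_min zero_le_one (sq_nonneg x)
    gcongr
  calc _ ≤ ‖Complex.I * (γ : ℂ) * u - (b : ℂ) ^ 2 * u ^ 2 / 2‖ + _ := norm_add_le _ _
    _ ≤ _ := add_le_add ((norm_sub_le _ _).trans (add_le_add h1 h2)) h3

/-- The constant and the truncation term are affine in `u`, so the second difference removes them.
-/
theorem levyKernel_second_difference (u s x : ℝ) :
    levyKernel u x - levyKernel (u + s) x / 2 - levyKernel (u - s) x / 2 =
      Complex.exp (u * x * Complex.I) * ((1 - Real.cos (s * x) : ℝ) : ℂ) := by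
  rw [exp_mul_one_sub_cos]
  simp only [levyKernel]
  push_cast
  rw [show Complex.I * (u : ℂ) * x = u * x * Complex.I by ring,
    show Complex.I * ((u : ℂ) + s) * x = (u + s) * x * Complex.I by ring,
    show Complex.I * ((u : ℂ) - s) * x = (u - s) * x * Complex.I by ring]
  ring

theorem integral_second_difference {μ : Measure ℝ} {f g k : ℝ → ℂ} (hf : Integrable f μ)
    (hg : Integrable g μ) (hk : Integrable k μ) :
    ∫ x, (f x - g x / 2 - k x / 2) ∂μ = ∫ x, f x ∂μ - (∫ x, g x ∂μ) / 2 - (∫ x, k x ∂μ) / 2 := by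
  have h1 : Integrable (fun x => f x - g x / 2) μ := hf.sub (hg.div_const 2)
  rw [integral_sub h1 (hk.div_const 2), integral_sub hf (hg.div_const 2), integral_div,
    integral_div]

/-- The drift is linear in `u` and disappears; it is recovered later from `sin`. The Gaussian part
leaves `b² s² / 2`, whose mean `b² / 6` over `s ∈ (0, 1]` becomes the atom at `0` of `limitMeasure`.
-/
theorem IsLevyMeasure.levyExponent_second_difference {ν : Measure ℝ} (hν : IsLevyMeasure ν)
    (γ b u s : ℝ) :
    levyExponent γ b ν u - levyExponent γ b ν (u + s) / 2 - levyExponent γ b ν (u - s) / 2 =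
      (b : ℂ) ^ 2 * s ^ 2 / 2 +
        ∫ x : ℝ, Complex.exp (u * x * Complex.I) * ((1 - Real.cos (s * x) : ℝ) : ℂ) ∂ν := by
  simp_rw [← levyKernel_second_difference]
  rw [integral_second_difference (hν.integrable_levyKernel u) (hν.integrable_levyKernel (u + s))
    (hν.integrable_levyKernel (u - s))]
  simp only [levyExponent]
  push_cast
  ring

/-! ### Vague convergence of the rescaled laws of small increments. -/

theorem norm_exp_sub_one_le_mul_exp (z : ℂ) : ‖Complex.exp z - 1‖ ≤ ‖z‖ * Real.exp ‖z‖ := by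
  have := Complex.norm_exp_sub_sum_le_norm_mul_exp z 1
  simpa using this

theorem tendsto_nat_mul_exp_div_sub_one (z : ℂ) :
    Tendsto (fun n : ℕ => (n : ℂ) * (Complex.exp (z / n) - 1)) atTop (𝓝 z) := by
  have h1 : HasDerivAt (fun w : ℂ => Complex.exp (z * w)) z 0 := by
    have := ((hasDerivAt_id (0 : ℂ)).const_mul z).cexp
    simpa using this
  have h2 := h1.tendsto_slope_zero
  have h3 : Tendsto (fun n : ℕ => ((n : ℂ))⁻¹) atTop (𝓝[≠] 0) := by
    refine tendsto_nhdsWithin_iff.2 ⟨?_, ?_⟩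
    · exact tendsto_inv_atTop_nhds_zero_nat
    · filter_upwards [eventually_ne_atTop 0] with n hn
      simpa using hn
  refine (h2.comp h3).congr fun n => ?_
  simp [div_eq_mul_inv]

/-- Uniform in `n`, hence usable for dominated convergence. -/
theorem norm_nat_mul_exp_div_sub_one_le (z : ℂ) {r : ℝ} (hz : ‖z‖ ≤ r) (n : ℕ) :
    ‖(n : ℂ) * (Complex.exp (z / n) - 1)‖ ≤ r * Real.exp r := by
  have hr : 0 ≤ r := (norm_nonneg z).trans hz
  rcases eq_or_ne n 0 with rfl | hn
  · simp; positivity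
  have hn1 : (1 : ℝ) ≤ n := by exact_mod_cast Nat.one_le_iff_ne_zero.2 hn
  rw [norm_mul, Complex.norm_natCast]
  have h := norm_exp_sub_one_le_mul_exp (z / n)
  rw [norm_div, Complex.norm_natCast] at h
  have h2 : ‖z‖ / n ≤ r := (div_le_self (norm_nonneg z) hn1).trans hz
  calc (n : ℝ) * ‖Complex.exp (z / n) - 1‖ ≤ n * (‖z‖ / n * Real.exp (‖z‖ / n)) := by gcongr
    _ = ‖z‖ * Real.exp (‖z‖ / n) := by field_simp
    _ ≤ r * Real.exp r := by gcongr

/-- The laws `p n` have characteristic exponent `t / n` times that of the triplet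
`(γ, b², ν)`. -/
structure IsInfinitesimalArray (p : ℕ → Measure ℝ) (t γ b : ℝ) (ν : Measure ℝ) : Prop where
  isProbabilityMeasure : ∀ n, IsProbabilityMeasure (p n)
  charFun_eq : ∀ n u, charFun (p n) u = Complex.exp (t * levyExponent γ b ν u / n)

/-- The weak limit of `n (1 - sin x / x) p n(dx)`. -/
noncomputable def limitMeasure (t b : ℝ) (ν : Measure ℝ) : Measure ℝ :=
  ENNReal.ofReal t • (ν.withDensity (fun x => ENNReal.ofReal (sincDefect x)) +
    ENNReal.ofReal (b ^ 2 / 6) • Measure.dirac 0)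

theorem IsLevyMeasure.isFiniteMeasure_limitMeasure {ν : Measure ℝ} (hν : IsLevyMeasure ν)
    (t b : ℝ) : IsFiniteMeasure (limitMeasure t b ν) := by
  have := isFiniteMeasure_withDensity_sincDefect hν.integrable
  have h2 : IsFiniteMeasure (ENNReal.ofReal (b ^ 2 / 6) • Measure.dirac (0 : ℝ)) :=
    Measure.smul_finite _ ENNReal.ofReal_ne_top
  exact Measure.smul_finite _ ENNReal.ofReal_ne_top

theorem IsLevyMeasure.charFun_limitMeasure {ν : Measure ℝ} (hν : IsLevyMeasure ν)
    {t : ℝ} (ht : 0 ≤ t) (γ b u : ℝ) :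
    charFun (limitMeasure t b ν) u = ∫ s in Set.Ioc (0 : ℝ) 1, (t : ℂ) *
      (levyExponent γ b ν u - levyExponent γ b ν (u + s) / 2 - levyExponent γ b ν (u - s) / 2) := by
  have := hν.sigmaFinite
  have hfin := isFiniteMeasure_withDensity_sincDefect hν.integrable
  have h2 : IsFiniteMeasure (ENNReal.ofReal (b ^ 2 / 6) • Measure.dirac (0 : ℝ)) :=
    Measure.smul_finite _ ENNReal.ofReal_ne_top
  have hint : ∀ (m : Measure ℝ) [IsFiniteMeasure m],
      Integrable (fun x : ℝ => Complex.exp (u * x * Complex.I)) m := by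
    intro m _
    refine (integrable_const (1 : ℝ)).mono' (by fun_prop) (Eventually.of_forall fun x => ?_)
    rw [← Complex.ofReal_mul, Complex.norm_exp_ofReal_mul_I]
  have hker : Integrable (fun s : ℝ => ∫ x : ℝ, Complex.exp (u * x * Complex.I) *
      ((1 - Real.cos (s * x) : ℝ) : ℂ) ∂ν) (volume.restrict (Set.Ioc (0 : ℝ) 1)) := by
    refine (integrable_const (2 * ∫ x : ℝ, min 1 (x ^ 2) ∂ν)).mono' ?_ ?_
    · refine (StronglyMeasurable.integral_prod_right (f := fun s x : ℝ =>
        Complex.exp (u * x * Complex.I) * ((1 - Real.cos (s * x) : ℝ) : ℂ)) ?_).aestronglyMeasurable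
      apply Continuous.stronglyMeasurable
      unfold Function.uncurry
      fun_prop
    · filter_upwards [ae_restrict_mem measurableSet_Ioc] with s hs
      rw [← integral_const_mul]
      refine norm_integral_le_of_norm_le (hν.integrable.const_mul _)
        (Eventually.of_forall fun x => ?_)
      rw [norm_mul, ← Complex.ofReal_mul, Complex.norm_exp_ofReal_mul_I, one_mul,
        Complex.norm_real, Real.norm_of_nonneg (by linarith [Real.cos_le_one (s * x)])]
      exact one_sub_cos_le (abs_le.2 ⟨by linarith [hs.1], hs.2⟩)
  rw [integral_const_mul]
  simp_rw [hν.levyExponent_second_difference]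
  rw [integral_add _ hker, ← integral_exp_mul_sincDefect hν.integrable]
  · rw [limitMeasure, charFun_apply_real, integral_smul_measure,
      integral_add_measure (hint _) (hint _), integral_smul_measure, integral_dirac,
      ENNReal.toReal_ofReal ht, ENNReal.toReal_ofReal (by positivity),
      ← charFun_apply_real, charFun_withDensity_sincDefect]
    have : ∫ s in Set.Ioc (0 : ℝ) 1, (b : ℂ) ^ 2 * (s : ℂ) ^ 2 / 2 = ((b ^ 2 / 6 : ℝ) : ℂ) := by
      have e : ∀ s : ℝ, (b : ℂ) ^ 2 * (s : ℂ) ^ 2 / 2 = ((b ^ 2 / 2 * s ^ 2 : ℝ) : ℂ) := by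
        intro s; push_cast; ring
      simp_rw [e]
      rw [integral_complex_ofReal, ← intervalIntegral.integral_of_le zero_le_one,
        intervalIntegral.integral_const_mul, integral_pow]
      norm_num
      ring
    rw [this]
    simp only [Complex.real_smul, Complex.ofReal_zero, mul_zero, zero_mul, Complex.exp_zero,
      mul_one]
    rw [add_comm ((b ^ 2 / 6 : ℝ) : ℂ)]
  · refine (Continuous.integrableOn_Icc (a := 0) (b := 1) (by fun_prop)).mono_set
      Set.Ioc_subset_Icc_self

/-- The constants `-1` cancel in the second difference; they are inserted so that each term `n (exp
(z / n) - 1)` converges by itself. -/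
theorem IsInfinitesimalArray.charFun_smul_withDensity {p : ℕ → Measure ℝ} {t γ b : ℝ}
    {ν : Measure ℝ} (h : IsInfinitesimalArray p t γ b ν) (n : ℕ) (u : ℝ) :
    charFun ((n : ENNReal) • (p n).withDensity fun x => ENNReal.ofReal (sincDefect x)) u =
      ∫ s in Set.Ioc (0 : ℝ) 1,
        ((n : ℂ) * (Complex.exp (t * levyExponent γ b ν u / n) - 1)
        - (n : ℂ) * (Complex.exp (t * levyExponent γ b ν (u + s) / n) - 1) / 2
        - (n : ℂ) * (Complex.exp (t * levyExponent γ b ν (u - s) / n) - 1) / 2) := by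
  have := h.isProbabilityMeasure n
  have hint : ∀ v : ℝ, Integrable (fun x : ℝ => Complex.exp (v * x * Complex.I)) (p n) := by
    intro v
    refine (integrable_const (1 : ℝ)).mono' (by fun_prop) (Eventually.of_forall fun x => ?_)
    rw [← Complex.ofReal_mul, Complex.norm_exp_ofReal_mul_I]
  rw [charFun_apply_real, integral_smul_measure, ← charFun_apply_real,
    charFun_withDensity_sincDefect, integral_exp_mul_sincDefect (integrable_min_one_sq _),
    ENNReal.toReal_natCast, Complex.real_smul, ← integral_const_mul]
  refine integral_congr_ae (Eventually.of_forall fun s => ?_)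
  simp only
  simp_rw [exp_mul_one_sub_cos]
  rw [integral_second_difference (hint u) (hint (u + s)) (hint (u - s)),
    ← charFun_apply_real, ← charFun_apply_real, ← charFun_apply_real,
    h.charFun_eq, h.charFun_eq, h.charFun_eq]
  push_cast
  ring

/-- The measures `n p n(dx)` converge to `t ν(dx)` on functions that vanish to second order
at `0`. -/
theorem IsInfinitesimalArray.tendsto_integral_mul_sincDefect {p : ℕ → Measure ℝ} {t γ b : ℝ}
    {ν : Measure ℝ} (h : IsInfinitesimalArray p t γ b ν) (ht : 0 ≤ t) (hν : IsLevyMeasure ν)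
    {H : ℝ → ℝ} (hH : Continuous H) {C : ℝ} (hC : ∀ x, |H x| ≤ C) :
    Tendsto (fun n : ℕ => (n : ℝ) * ∫ x, H x * sincDefect x ∂(p n)) atTop
      (𝓝 (t * (∫ x, H x * sincDefect x ∂ν + b ^ 2 / 6 * H 0))) := by
  have hfin := hν.isFiniteMeasure_limitMeasure t b
  have hfin' := isFiniteMeasure_withDensity_sincDefect hν.integrable
  have h2 : IsFiniteMeasure (ENNReal.ofReal (b ^ 2 / 6) • Measure.dirac (0 : ℝ)) :=
    Measure.smul_finite _ ENNReal.ofReal_ne_top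
  have hfinn : ∀ n : ℕ, IsFiniteMeasure
      ((n : ENNReal) • (p n).withDensity fun x => ENNReal.ofReal (sincDefect x)) := fun n => by
    have := h.isProbabilityMeasure n
    have := isFiniteMeasure_withDensity_sincDefect (integrable_min_one_sq (p n))
    exact Measure.smul_finite _ (ENNReal.natCast_ne_top n)
  have hint : ∀ (m : Measure ℝ) [IsFiniteMeasure m], Integrable H m := by
    intro m _
    exact (integrable_const C).mono' hH.aestronglyMeasurable (Eventually.of_forall hC)
  have key := tendsto_integral_of_tendsto_charFun (m := fun n : ℕ =>
    (n : ENNReal) • (p n).withDensity fun x => ENNReal.ofReal (sincDefect x))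
    (m₀ := limitMeasure t b ν) ?_ hH hC
  · simp_rw [integral_smul_measure, integral_withDensity_sincDefect] at key
    rw [limitMeasure, integral_smul_measure, integral_add_measure (hint _) (hint _),
      integral_withDensity_sincDefect, integral_smul_measure, integral_dirac,
      ENNReal.toReal_ofReal ht, ENNReal.toReal_ofReal (by positivity)] at key
    simpa using key
  · intro u
    rw [hν.charFun_limitMeasure ht γ]
    simp_rw [h.charFun_smul_withDensity]
    -- One bound for the exponent on `|v| ≤ |u| + 1`, a range that contains `u` and `u ± s` for all
    -- `s ∈ (0, 1]`.
    set D := t * (|γ| * (|u| + 1) + b ^ 2 * (|u| + 1) ^ 2 / 2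
      + (3 * (|u| + 1) ^ 2 + 2) * ∫ x : ℝ, min 1 (x ^ 2) ∂ν) with hD
    have hbound : ∀ v : ℝ, |v| ≤ |u| + 1 → ‖(t : ℂ) * levyExponent γ b ν v‖ ≤ D := by
      intro v hv
      rw [norm_mul, Complex.norm_real, Real.norm_of_nonneg ht, hD]
      exact mul_le_mul_of_nonneg_left (hν.norm_levyExponent_le γ b hv) ht
    refine tendsto_integral_of_dominated_convergence (fun _ => 2 * (D * Real.exp D)) ?_
      (integrable_const _) ?_ ?_
    · intro n
      have := h.isProbabilityMeasure n
      simp_rw [← h.charFun_eq]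
      have hm : Measurable (charFun (p n)) := measurable_charFun
      apply Measurable.aestronglyMeasurable
      fun_prop
    · intro n
      filter_upwards [ae_restrict_mem measurableSet_Ioc] with s hs
      have hs' : |s| ≤ 1 := abs_le.2 ⟨by linarith [hs.1], hs.2⟩
      have b0 := norm_nat_mul_exp_div_sub_one_le _ (hbound u (by linarith)) n
      have b1 := norm_nat_mul_exp_div_sub_one_le _ (hbound (u + s)
        ((abs_add_le _ _).trans (by linarith))) n
      have b2 := norm_nat_mul_exp_div_sub_one_le _ (hbound (u - s)
        ((abs_sub _ _).trans (by linarith))) n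
      refine (norm_sub_le _ _).trans ?_
      refine (add_le_add_left (norm_sub_le _ _) _).trans ?_
      rw [norm_div, norm_div, show ‖(2 : ℂ)‖ = 2 by simp]
      linarith
    · refine Eventually.of_forall fun s => ?_
      have := ((tendsto_nat_mul_exp_div_sub_one (t * levyExponent γ b ν u)).sub
        ((tendsto_nat_mul_exp_div_sub_one (t * levyExponent γ b ν (u + s))).div_const 2)).sub
        ((tendsto_nat_mul_exp_div_sub_one (t * levyExponent γ b ν (u - s))).div_const 2)
      convert this using 2
      ring

/-! ### Recovering the drift from the sine. -/

theorem integral_sin_eq_im_charFun (p : Measure ℝ) [IsProbabilityMeasure p] :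
    ∫ x, Real.sin x ∂p = (charFun p 1 - 1).im := by
  rw [charFun_apply_real, Complex.sub_im, Complex.one_im, sub_zero]
  have hint : Integrable (fun x : ℝ => Complex.exp (((1 : ℝ) : ℂ) * x * Complex.I)) p := by
    refine (integrable_const (1 : ℝ)).mono' (by fun_prop) (Eventually.of_forall fun x => ?_)
    rw [← Complex.ofReal_mul, Complex.norm_exp_ofReal_mul_I]
  have := integral_im hint
  simp only [RCLike.im_to_complex] at this
  rw [← this]
  refine integral_congr_ae (Eventually.of_forall fun x => ?_)
  simp only
  rw [← Complex.ofReal_mul, Complex.exp_ofReal_mul_I_im, one_mul]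

theorem im_levyKernel_one (x : ℝ) :
    (levyKernel 1 x).im = Real.sin x - Set.indicator {y : ℝ | |y| ≤ 1} (fun y => y) x := by
  have h1 : (Complex.exp (Complex.I * (1 : ℝ) * x)).im = Real.sin x := by
    rw [show Complex.I * ((1 : ℝ) : ℂ) * x = x * Complex.I by push_cast; ring,
      Complex.exp_ofReal_mul_I_im]
  rw [levyKernel, Complex.sub_im, Complex.sub_im, h1]
  by_cases hx : x ∈ {y : ℝ | |y| ≤ 1}
  · rw [Set.indicator_of_mem hx, Set.indicator_of_mem hx]; simp
  · rw [Set.indicator_of_notMem hx, Set.indicator_of_notMem hx]; simp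

theorem IsLevyMeasure.im_levyExponent_one {ν : Measure ℝ} (hν : IsLevyMeasure ν) (γ b : ℝ) :
    (levyExponent γ b ν 1).im =
      γ + ∫ x, (Real.sin x - Set.indicator {y : ℝ | |y| ≤ 1} (fun y => y) x) ∂ν := by
  have := integral_im (hν.integrable_levyKernel 1)
  simp only [RCLike.im_to_complex, im_levyKernel_one] at this
  rw [this, levyExponent, Complex.add_im, Complex.sub_im]
  congr 1
  have : (b : ℂ) ^ 2 * ((1 : ℝ) : ℂ) ^ 2 / 2 = ((b ^ 2 / 2 : ℝ) : ℂ) := by push_cast; ring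
  rw [this, Complex.ofReal_im]
  simp

theorem IsLevyMeasure.integrable_sin_sub {ν : Measure ℝ} (hν : IsLevyMeasure ν) :
    Integrable (fun x => Real.sin x - Set.indicator {y : ℝ | |y| ≤ 1} (fun y => y) x) ν := by
  have := (hν.integrable_levyKernel 1).im
  simpa only [RCLike.im_to_complex, im_levyKernel_one] using this

/-- Second differences do not see the drift. The function `sin` is bounded, agrees with `x` to first
order and is the imaginary part of `exp (i x)`, so its integral is read off the exponent at `u = 1`.
The Gaussian term is real and drops out. -/
theorem IsInfinitesimalArray.tendsto_integral_sin {p : ℕ → Measure ℝ} {t γ b : ℝ}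
    {ν : Measure ℝ} (h : IsInfinitesimalArray p t γ b ν) (hν : IsLevyMeasure ν) :
    Tendsto (fun n : ℕ => (n : ℝ) * ∫ x, Real.sin x ∂(p n)) atTop
      (𝓝 (t * (γ + ∫ x, (Real.sin x - Set.indicator {y : ℝ | |y| ≤ 1} (fun y => y) x) ∂ν))) := by
  have h1 := (Complex.continuous_im.tendsto _).comp
    (tendsto_nat_mul_exp_div_sub_one (t * levyExponent γ b ν 1))
  rw [Complex.im_ofReal_mul, hν.im_levyExponent_one] at h1
  refine h1.congr fun n => ?_
  have := h.isProbabilityMeasure n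
  rw [Function.comp_apply, integral_sin_eq_im_charFun, h.charFun_eq, ← Complex.ofReal_natCast,
    Complex.im_ofReal_mul]

/-! ### Limits of moment generating functions of transformed increments. -/

theorem abs_exp_sub_quadratic_le {y : ℝ} (hy : |y| ≤ 1) :
    |Real.exp y - 1 - y - y ^ 2 / 2| ≤ |y| ^ 3 := by
  have h := Real.exp_bound hy (n := 3) (by norm_num)
  have h3 : (0 : ℝ) ≤ |y| ^ 3 := by positivity
  norm_num [Finset.sum_range_succ, Nat.factorial] at h
  rw [show Real.exp y - 1 - y - y ^ 2 / 2 = Real.exp y - (1 + y + y ^ 2 / 2) by ring]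
  linarith

/-- Subtracting `l sin x` instead of `l x` removes the linear part and keeps the function bounded.
Against the limit `1 / 6` for the weight this gives the value `3 l²` used in `expRatio`. -/
theorem tendsto_exp_sub_sin_div_sq (l : ℝ) :
    Tendsto (fun x : ℝ => (Real.exp (l * x) - 1 - l * Real.sin x) / x ^ 2) (𝓝[≠] 0)
      (𝓝 (l ^ 2 / 2)) := by
  rw [← tendsto_sub_nhds_zero_iff]
  have hz : Tendsto (fun x : ℝ => (|l| ^ 3 + |l|) * |x|) (𝓝[≠] 0) (𝓝 0) := by
    have : Tendsto (fun x : ℝ => (|l| ^ 3 + |l|) * |x|) (𝓝 0) (𝓝 ((|l| ^ 3 + |l|) * |0|)) :=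
      (continuous_const.mul continuous_abs).tendsto 0
    simp only [abs_zero, mul_zero] at this
    exact this.mono_left nhdsWithin_le_nhds
  have h1 : ∀ᶠ x : ℝ in 𝓝[≠] 0, |l * x| ≤ 1 := by
    have : Tendsto (fun x : ℝ => |l * x|) (𝓝 0) (𝓝 |l * 0|) := by
      apply Continuous.tendsto (f := fun x : ℝ => |l * x|); fun_prop
    rw [mul_zero, abs_zero] at this
    exact nhdsWithin_le_nhds (this.eventually (ge_mem_nhds one_pos))
  have h2 : ∀ᶠ x : ℝ in 𝓝[≠] 0, |x| ≤ 1 := by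
    have : Tendsto (fun x : ℝ => |x|) (𝓝 0) (𝓝 |0|) := continuous_abs.tendsto 0
    rw [abs_zero] at this
    exact nhdsWithin_le_nhds (this.eventually (ge_mem_nhds one_pos))
  refine squeeze_zero_norm' ?_ hz
  filter_upwards [h1, h2, self_mem_nhdsWithin] with x hx1 hx2 hx0
  have hx0' : x ≠ 0 := hx0
  have hxp : 0 < |x| := abs_pos.2 hx0'
  have hb := abs_exp_sub_quadratic_le hx1
  have hs := Real.sin_bound hx2
  have hs2 : |Real.sin x - x| ≤ |x| ^ 3 := by
    have e : Real.sin x - x = (Real.sin x - (x - x ^ 3 / 6)) - x ^ 3 / 6 := by ring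
    have h5 : |x| ^ 5 ≤ |x| ^ 3 := pow_le_pow_of_le_one (abs_nonneg x) hx2 (by norm_num)
    rw [e]
    refine (abs_sub _ _).trans ?_
    rw [abs_div, abs_pow, abs_of_pos (show (0 : ℝ) < 6 by norm_num)]
    have : (0 : ℝ) ≤ |x| ^ 3 := by positivity
    linarith
  have e : (Real.exp (l * x) - 1 - l * Real.sin x) / x ^ 2 - l ^ 2 / 2 =
      ((Real.exp (l * x) - 1 - l * x - (l * x) ^ 2 / 2) - l * (Real.sin x - x)) / x ^ 2 := by
    field_simp; ring
  rw [e, Real.norm_eq_abs, abs_div, abs_of_nonneg (sq_nonneg x), div_le_iff₀ (by positivity)]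
  refine (abs_sub _ _).trans ?_
  rw [abs_mul l]
  have e2 : (|l| ^ 3 + |l|) * |x| * x ^ 2 = |l * x| ^ 3 + |l| * |x| ^ 3 := by
    rw [abs_mul, ← sq_abs x]; ring
  rw [e2]
  gcongr

theorem tendsto_sincDefect_div_sq :
    Tendsto (fun x : ℝ => sincDefect x / x ^ 2) (𝓝[≠] 0) (𝓝 (1 / 6)) := by
  rw [← tendsto_sub_nhds_zero_iff]
  have hz : Tendsto (fun x : ℝ => x ^ 2) (𝓝[≠] 0) (𝓝 0) := by
    have : Tendsto (fun x : ℝ => x ^ 2) (𝓝 0) (𝓝 (0 ^ 2)) := (continuous_pow 2).tendsto 0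
    rw [zero_pow two_ne_zero] at this
    exact this.mono_left nhdsWithin_le_nhds
  have h2 : ∀ᶠ x : ℝ in 𝓝[≠] 0, |x| ≤ 1 := by
    have : Tendsto (fun x : ℝ => |x|) (𝓝 0) (𝓝 |0|) := continuous_abs.tendsto 0
    rw [abs_zero] at this
    exact nhdsWithin_le_nhds (this.eventually (ge_mem_nhds one_pos))
  refine squeeze_zero_norm' ?_ hz
  filter_upwards [h2, self_mem_nhdsWithin] with x hx hx0
  have hx0' : x ≠ 0 := hx0
  have e : sincDefect x / x ^ 2 - 1 / 6 = (sincDefect x - x ^ 2 / 6) / x ^ 2 := by field_simp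
  rw [e, Real.norm_eq_abs, abs_div, abs_of_nonneg (sq_nonneg x), div_le_iff₀ (by positivity)]
  exact (abs_sincDefect_sub_le hx).trans (by ring_nf; rfl)

/-- `(exp (l g) - 1 - l sin) / (1 - sin x / x)`, extended by its limit at `0`. -/
noncomputable def expRatio (g : ℝ → ℝ) (l : ℝ) : ℝ → ℝ :=
  Function.update (fun x => (Real.exp (l * g x) - 1 - l * Real.sin x) / sincDefect x) 0 (3 * l ^ 2)

theorem expRatio_mul {g : ℝ → ℝ} (hg0 : g 0 = 0) (l x : ℝ) :
    expRatio g l x * sincDefect x = Real.exp (l * g x) - 1 - l * Real.sin x := by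
  by_cases hx : x = 0
  · simp [hx, sincDefect_zero, hg0]
  · rw [expRatio, Function.update_of_ne hx, div_mul_cancel₀ _ (sincDefect_pos hx).ne']

theorem continuous_expRatio {g : ℝ → ℝ} (hg : Continuous g) {ε : ℝ} (hε : 0 < ε)
    (hgε : ∀ x, |x| ≤ ε → g x = x) (l : ℝ) : Continuous (expRatio g l) := by
  rw [continuous_iff_continuousAt]
  intro x
  by_cases hx : x = 0
  · subst hx
    rw [expRatio, continuousAt_update_same]
    have h := (tendsto_exp_sub_sin_div_sq l).div tendsto_sincDefect_div_sq (by norm_num)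
    rw [show l ^ 2 / 2 / (1 / 6) = 3 * l ^ 2 by ring] at h
    refine h.congr' ?_
    have h2 : ∀ᶠ x : ℝ in 𝓝[≠] 0, |x| ≤ ε := by
      have : Tendsto (fun x : ℝ => |x|) (𝓝 0) (𝓝 |0|) := continuous_abs.tendsto 0
      rw [abs_zero] at this
      exact nhdsWithin_le_nhds (this.eventually (ge_mem_nhds hε))
    filter_upwards [h2, self_mem_nhdsWithin] with x hx hx0
    have hx0' : x ^ 2 ≠ 0 := pow_ne_zero 2 hx0
    simp only [Pi.div_apply]
    rw [hgε x hx, div_div_div_cancel_right₀ hx0']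
  · rw [expRatio, continuousAt_update_of_ne hx]
    refine ContinuousAt.div ?_ continuous_sincDefect.continuousAt (sincDefect_pos hx).ne'
    fun_prop

theorem exp_mul_le_exp_abs_mul (l : ℝ) {y C : ℝ} (hy : |y| ≤ C) :
    Real.exp (l * y) ≤ Real.exp (|l| * C) := by
  refine Real.exp_le_exp.2 ((le_abs_self _).trans ?_)
  rw [abs_mul]
  exact mul_le_mul_of_nonneg_left hy (abs_nonneg l)

theorem exists_bound_expRatio {g : ℝ → ℝ} (hg : Continuous g) {ε : ℝ} (hε : 0 < ε)
    (hgε : ∀ x, |x| ≤ ε → g x = x) {C : ℝ} (hC : ∀ x, |g x| ≤ C) (l : ℝ) :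
    ∃ D, ∀ x, |expRatio g l x| ≤ D := by
  obtain ⟨D, hD⟩ := (isCompact_Icc (a := (-2 : ℝ)) (b := 2)).exists_bound_of_continuousOn
    (continuous_expRatio hg hε hgε l).continuousOn
  -- The factor `2` is the reciprocal of the lower bound `1 / 2` of the weight on `|x| ≥ 2`.
  refine ⟨max D (2 * (Real.exp (|l| * C) + 1 + |l|)), fun x => ?_⟩
  rcases le_or_gt |x| 2 with h | h
  · exact (hD x (abs_le.1 h)).trans (le_max_left _ _)
  · refine le_trans ?_ (le_max_right _ _)
    have hx : x ≠ 0 := by rintro rfl; norm_num at h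
    have hw := half_le_sincDefect h.le
    rw [expRatio, Function.update_of_ne hx, abs_div, abs_of_nonneg (sincDefect_nonneg x),
      div_le_iff₀ (by linarith)]
    have h1 : |Real.exp (l * g x) - 1 - l * Real.sin x| ≤ Real.exp (|l| * C) + 1 + |l| := by
      refine (abs_sub _ _).trans (add_le_add ((abs_sub _ _).trans ?_) ?_)
      · rw [Real.abs_exp, abs_one]
        gcongr ?_ + 1
        exact exp_mul_le_exp_abs_mul l (hC x)
      · rw [abs_mul]
        exact mul_le_of_le_one_right (abs_nonneg l) (Real.abs_sin_le_one x)
    have h2 : 0 ≤ Real.exp (|l| * C) + 1 + |l| := by positivity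
    nlinarith

/-- The Laplace exponent of the triplet `(γ, b², ν)` with the jumps transformed by `g`. -/
noncomputable def laplaceExponent (γ b : ℝ) (ν : Measure ℝ) (g : ℝ → ℝ) (l : ℝ) : ℝ :=
  l * γ + b ^ 2 * l ^ 2 / 2 +
    ∫ x, (Real.exp (l * g x) - 1 - l * Set.indicator {y : ℝ | |y| ≤ 1} (fun y => y) x) ∂ν

/-- Decompose `exp (l g) - 1` as `expRatio g l * sincDefect + l sin` and pass to the limit in each
term. The atom `b² / 6` at `0` meets the value `3 l²` and yields the Gaussian term `b² l² / 2`. -/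
theorem IsInfinitesimalArray.tendsto_mgf {p : ℕ → Measure ℝ} {t γ b : ℝ}
    {ν : Measure ℝ} (h : IsInfinitesimalArray p t γ b ν) (ht : 0 ≤ t) (hν : IsLevyMeasure ν)
    {g : ℝ → ℝ} (hg : Continuous g) {ε : ℝ} (hε : 0 < ε)
    (hgε : ∀ x, |x| ≤ ε → g x = x) {C : ℝ} (hC : ∀ x, |g x| ≤ C) (l : ℝ) :
    Tendsto (fun n : ℕ => (n : ℝ) * (mgf g (p n) l - 1)) atTop
      (𝓝 (t * laplaceExponent γ b ν g l)) := by
  have hg0 : g 0 = 0 := hgε 0 (by simpa using hε.le)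
  obtain ⟨D, hD⟩ := exists_bound_expRatio hg hε hgε hC l
  have hcont := continuous_expRatio hg hε hgε l
  have h1 := h.tendsto_integral_mul_sincDefect ht hν hcont hD
  have h2 := (h.tendsto_integral_sin hν).const_mul l
  have h3 := h1.add h2
  simp_rw [expRatio_mul hg0] at h3
  have hintH : Integrable (fun x => Real.exp (l * g x) - 1 - l * Real.sin x) ν := by
    refine ((integrable_sincDefect hν.integrable).const_mul D).mono' (by fun_prop)
      (Eventually.of_forall fun x => ?_)
    rw [← expRatio_mul hg0, norm_mul, Real.norm_of_nonneg (sincDefect_nonneg x)]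
    exact mul_le_mul_of_nonneg_right (hD x) (sincDefect_nonneg x)
  have hlim : t * (∫ x, (Real.exp (l * g x) - 1 - l * Real.sin x) ∂ν
      + b ^ 2 / 6 * expRatio g l 0) + l * (t * (γ + ∫ x, (Real.sin x -
        Set.indicator {y : ℝ | |y| ≤ 1} (fun y => y) x) ∂ν)) = t * laplaceExponent γ b ν g l := by
    have e : laplaceExponent γ b ν g l = l * γ + b ^ 2 * l ^ 2 / 2 +
        (∫ x, (Real.exp (l * g x) - 1 - l * Real.sin x) ∂ν + l * ∫ x, (Real.sin x -
        Set.indicator {y : ℝ | |y| ≤ 1} (fun y => y) x) ∂ν) := by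
      rw [laplaceExponent, ← integral_const_mul, ← integral_add hintH
        (hν.integrable_sin_sub.const_mul l)]
      congr 1
      refine integral_congr_ae (Eventually.of_forall fun x => ?_)
      simp only
      ring
    rw [e, expRatio, Function.update_self]
    ring
  rw [hlim] at h3
  refine h3.congr fun n => ?_
  have := h.isProbabilityMeasure n
  have i1 : Integrable (fun x => Real.exp (l * g x)) (p n) := by
    refine (integrable_const (Real.exp (|l| * C))).mono' (by fun_prop)
      (Eventually.of_forall fun x => ?_)
    rw [Real.norm_of_nonneg (Real.exp_pos _).le]
    exact exp_mul_le_exp_abs_mul l (hC x)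
  have i2 : Integrable (fun x => l * Real.sin x) (p n) := by
    refine (integrable_const |l|).mono' (by fun_prop) (Eventually.of_forall fun x => ?_)
    rw [Real.norm_eq_abs, abs_mul]
    exact mul_le_of_le_one_right (abs_nonneg l) (Real.abs_sin_le_one x)
  have i3 : Integrable (fun x => Real.exp (l * g x) - 1) (p n) := i1.sub (integrable_const 1)
  rw [integral_sub i3 i2, integral_sub i1 (integrable_const 1), integral_const_mul, mgf]
  simp
  ring

/-! ### Passing to the limit in expectations bounded in `L²`. -/

theorem sub_min_le_sq_div {y C : ℝ} (hC : 0 < C) : |y - min y C| ≤ y ^ 2 / C := by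
  rcases le_total y C with h | h
  · rw [min_eq_left h, sub_self, abs_zero]; positivity
  · rw [min_eq_right h, abs_of_nonneg (sub_nonneg.2 h), le_div_iff₀ hC]
    nlinarith

theorem abs_integral_sub_integral_min_le {Ω : Type*} [MeasurableSpace Ω] {P : Measure Ω}
    {Y : Ω → ℝ} {K C : ℝ} (hC : 0 < C) (h1 : Integrable Y P)
    (hm : Integrable (fun ω => min (Y ω) C) P)
    (h2 : Integrable (fun ω => Y ω ^ 2) P) (hK : ∫ ω, Y ω ^ 2 ∂P ≤ K) :
    |∫ ω, Y ω ∂P - ∫ ω, min (Y ω) C ∂P| ≤ K / C := by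
  rw [← integral_sub h1 hm, ← Real.norm_eq_abs]
  refine (norm_integral_le_of_norm_le (h2.div_const C)
    (Eventually.of_forall fun ω => sub_min_le_sq_div hC)).trans ?_
  rw [integral_div]
  gcongr

/-- Expectations converge along an almost surely convergent sequence that is bounded in `L²`. -/
theorem integral_eq_of_tendsto_of_sq_bounded {Ω : Type*} [MeasurableSpace Ω] {P : Measure Ω}
    [IsProbabilityMeasure P] {Y : ℕ → Ω → ℝ} {Z : Ω → ℝ} {K M : ℝ}
    (hY : ∀ n, AEMeasurable (Y n) P) (hpos : ∀ n ω, 0 ≤ Y n ω) (hZpos : ∀ ω, 0 ≤ Z ω)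
    (hYZ : ∀ᵐ ω ∂P, Tendsto (fun n => Y n ω) atTop (𝓝 (Z ω)))
    (hsq : ∀ n, Integrable (fun ω => Y n ω ^ 2) P) (hK : ∀ n, ∫ ω, Y n ω ^ 2 ∂P ≤ K)
    (hM : Tendsto (fun n => ∫ ω, Y n ω ∂P) atTop (𝓝 M)) :
    Integrable Z P ∧ ∫ ω, Z ω ∂P = M := by
  have hZ : AEMeasurable Z P := aemeasurable_of_tendsto_metrizable_ae _ hY hYZ
  -- Fatou's lemma carries the second-moment bound to the limit.
  have hlin : ∫⁻ ω, ENNReal.ofReal (Z ω ^ 2) ∂P ≤ ENNReal.ofReal K := by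
    calc ∫⁻ ω, ENNReal.ofReal (Z ω ^ 2) ∂P
        = ∫⁻ ω, liminf (fun n => ENNReal.ofReal (Y n ω ^ 2)) atTop ∂P := by
          refine lintegral_congr_ae ?_
          filter_upwards [hYZ] with ω hω
          exact (((ENNReal.continuous_ofReal.tendsto _).comp (hω.pow 2)).liminf_eq).symm
      _ ≤ liminf (fun n => ∫⁻ ω, ENNReal.ofReal (Y n ω ^ 2) ∂P) atTop :=
          lintegral_liminf_le' fun n => ((hY n).pow_const 2).ennreal_ofReal
      _ ≤ ENNReal.ofReal K := by
          refine liminf_le_of_le (by isBoundedDefault) fun b hb => ?_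
          obtain ⟨n, hn⟩ := hb.exists
          refine hn.trans ?_
          rw [← ofReal_integral_eq_lintegral_ofReal (hsq n)
            (Eventually.of_forall fun ω => sq_nonneg _)]
          exact ENNReal.ofReal_le_ofReal (hK n)
  have hZsq : Integrable (fun ω => Z ω ^ 2) P := by
    refine ⟨(hZ.pow_const 2).aestronglyMeasurable, ?_⟩
    rw [hasFiniteIntegral_iff_ofReal (Eventually.of_forall fun ω => sq_nonneg _)]
    exact hlin.trans_lt ENNReal.ofReal_lt_top
  have hK0 : 0 ≤ K := (integral_nonneg fun ω => sq_nonneg (Y 0 ω)).trans (hK 0)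
  have hZK : ∫ ω, Z ω ^ 2 ∂P ≤ K := by
    rw [← ofReal_integral_eq_lintegral_ofReal hZsq
      (Eventually.of_forall fun ω => sq_nonneg _)] at hlin
    exact (ENNReal.ofReal_le_ofReal_iff hK0).1 hlin
  have hint : ∀ {W : Ω → ℝ}, AEMeasurable W P → Integrable (fun ω => W ω ^ 2) P →
      Integrable W P := by
    intro W hW hW2
    refine ((integrable_const (1 : ℝ)).add hW2).mono' hW.aestronglyMeasurable
      (Eventually.of_forall fun ω => ?_)
    simp only [Pi.add_apply, Real.norm_eq_abs]
    nlinarith [sq_nonneg (|W ω| - 1), sq_abs (W ω)]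
  have hmin : ∀ {W : Ω → ℝ} {C : ℝ}, 0 < C → (∀ ω, 0 ≤ W ω) → AEMeasurable W P →
      Integrable (fun ω => min (W ω) C) P := by
    intro W C hC hW0 hW
    refine (integrable_const C).mono' (hW.min aemeasurable_const).aestronglyMeasurable
      (Eventually.of_forall fun ω => ?_)
    rw [Real.norm_of_nonneg (le_min (hW0 ω) hC.le)]
    exact min_le_right _ _
  refine ⟨hint hZ hZsq, ?_⟩
  -- Truncation at `C` costs at most `K / C` for every `Y n` and for `Z`; the truncated expectations
  -- converge by domination, and then `C` tends to infinity.
  have hkey : ∀ C : ℝ, 0 < C → |∫ ω, Z ω ∂P - M| ≤ 2 * K / C := by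
    intro C hC
    have hT : Tendsto (fun n => ∫ ω, min (Y n ω) C ∂P) atTop (𝓝 (∫ ω, min (Z ω) C ∂P)) := by
      refine tendsto_integral_of_dominated_convergence (fun _ => C)
        (fun n => (hmin hC (hpos n) (hY n)).1) (integrable_const C) ?_ ?_
      · intro n
        refine Eventually.of_forall fun ω => ?_
        rw [Real.norm_of_nonneg (le_min (hpos n ω) hC.le)]
        exact min_le_right _ _
      · filter_upwards [hYZ] with ω hω using hω.min tendsto_const_nhds
    have h1 : |M - ∫ ω, min (Z ω) C ∂P| ≤ K / C :=
      le_of_tendsto (hM.sub hT).abs (Eventually.of_forall fun n =>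
        abs_integral_sub_integral_min_le hC (hint (hY n) (hsq n)) (hmin hC (hpos n) (hY n))
          (hsq n) (hK n))
    have h2 := abs_integral_sub_integral_min_le hC (hint hZ hZsq) (hmin hC hZpos hZ) hZsq hZK
    rw [abs_le] at *
    rw [mul_div_assoc]
    constructor <;> linarith [h1.1, h1.2, h2.1, h2.2]
  by_contra hne
  have hpos' : 0 < |∫ ω, Z ω ∂P - M| := abs_pos.2 (sub_ne_zero.2 hne)
  have hT : Tendsto (fun C : ℝ => 2 * K / C) atTop (𝓝 0) := tendsto_const_nhds.div_atTop tendsto_id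
  obtain ⟨C, hC1, hC2⟩ := ((hT.eventually (gt_mem_nhds hpos')).and (eventually_gt_atTop 0)).exists
  exact absurd (hkey C hC2) (not_le.2 hC1)

/-- If the moment generating functions of an almost surely convergent sequence converge
everywhere, then to that of the limit. -/
theorem mgf_eq_of_tendsto {Ω : Type*} [MeasurableSpace Ω] {P : Measure Ω}
    [IsProbabilityMeasure P] {S : ℕ → Ω → ℝ} {Z : Ω → ℝ} {M : ℝ → ℝ}
    (hS : ∀ n, AEMeasurable (S n) P)
    (hSZ : ∀ᵐ ω ∂P, Tendsto (fun n => S n ω) atTop (𝓝 (Z ω)))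
    (hint : ∀ n l, Integrable (fun ω => Real.exp (l * S n ω)) P)
    (hM : ∀ l, Tendsto (fun n => mgf (S n) P l) atTop (𝓝 (M l))) (l : ℝ) :
    Integrable (fun ω => Real.exp (l * Z ω)) P ∧ mgf Z P l = M l := by
  have hsq : ∀ (n : ℕ) (ω : Ω), Real.exp (l * S n ω) ^ 2 = Real.exp (2 * l * S n ω) := by
    intro n ω
    rw [← Real.exp_nat_mul]; congr 1; push_cast; ring
  -- The second moment of `exp (l S n)` is the generating function at `2 l`, which converges and so
  -- is bounded in `n`.
  obtain ⟨K, hK⟩ := (hM (2 * l)).bddAbove_range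
  refine integral_eq_of_tendsto_of_sq_bounded (K := K) (Y := fun n ω => Real.exp (l * S n ω))
    (fun n => ((hS n).const_mul l).exp) (fun _ _ => (Real.exp_pos _).le)
    (fun _ => (Real.exp_pos _).le) ?_ ?_ ?_ (hM l)
  · filter_upwards [hSZ] with ω hω
    exact (Real.continuous_exp.tendsto _).comp (hω.const_mul l)
  · intro n; simp_rw [hsq]; exact hint n (2 * l)
  · intro n; simp_rw [hsq]; exact hK ⟨n, rfl⟩

/-! ### The Laplace transform after a continuous transformation of the jumps. -/

theorem IsLevyProcess.isInfinitesimalArray {Ω : Type*} [MeasurableSpace Ω] {P : Measure Ω}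
    [IsProbabilityMeasure P] {X : ℝ≥0 → Ω → ℝ} {γ b : ℝ} {ν : Measure ℝ}
    (hX : IsLevyProcess P X) (hT : HasTriplet P X γ b ν) (t : ℝ≥0) :
    IsInfinitesimalArray (fun n => P.map (X (t / n))) t γ b ν where
  isProbabilityMeasure n := Measure.isProbabilityMeasure_map (hX.measurable _).aemeasurable
  charFun_eq n u := by
    rw [charFun_apply_real, integral_map (hX.measurable _).aemeasurable (by fun_prop)]
    -- The index `n = 0` is covered as well: division by zero gives time `0` and exponent `0`.
    have h := hT.charFun_eq (t / n) u
    simp_rw [show ∀ x : ℝ, (u : ℂ) * x * Complex.I = Complex.I * u * x from fun x => by ring]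
    rw [h]
    congr 1
    simp only [levyExponent, levyKernel]
    push_cast
    ring

theorem integrable_exp_mul_of_bounded {Ω : Type*} [MeasurableSpace Ω] {P : Measure Ω}
    [IsFiniteMeasure P] {Y : Ω → ℝ} (hY : AEMeasurable Y P) {C : ℝ} (hC : ∀ ω, |Y ω| ≤ C) (l : ℝ) :
    Integrable (fun ω => Real.exp (l * Y ω)) P := by
  refine (integrable_const (Real.exp (|l| * C))).mono'
    ((hY.const_mul l).exp).aestronglyMeasurable (Eventually.of_forall fun ω => ?_)
  rw [Real.norm_of_nonneg (Real.exp_pos _).le]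
  exact exp_mul_le_exp_abs_mul l (hC ω)

theorem IsLevyProcess.mgf_sum_increments {Ω : Type*} [MeasurableSpace Ω] {P : Measure Ω}
    [IsProbabilityMeasure P] {X : ℝ≥0 → Ω → ℝ}
    (hX : IsLevyProcess P X) (t : ℝ≥0) {g : ℝ → ℝ} (hg : Measurable g) (n : ℕ) (l : ℝ) :
    mgf (fun ω => ∑ k ∈ Finset.range n,
        g (X (gridPoint t n (k + 1)) ω - X (gridPoint t n k) ω)) P l =
      mgf g (P.map (X (t / n))) l ^ n := by
  have hind : iIndepFun (fun k ω => g (X (gridPoint t n (k + 1)) ω - X (gridPoint t n k) ω)) P :=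
    (hX.indep.nat (gridPoint_monotone t n)).comp (fun _ => g) (fun _ => hg)
  have hmeas : ∀ k, Measurable
      (fun ω => g (X (gridPoint t n (k + 1)) ω - X (gridPoint t n k) ω)) :=
    fun k => hg.comp ((hX.measurable _).sub (hX.measurable _))
  have h := hind.mgf_sum (t := l) hmeas (Finset.range n)
  have e : (fun ω => ∑ k ∈ Finset.range n,
        g (X (gridPoint t n (k + 1)) ω - X (gridPoint t n k) ω)) =
      ∑ k ∈ Finset.range n, fun ω => g (X (gridPoint t n (k + 1)) ω - X (gridPoint t n k) ω) := by
    ext ω; simp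
  rw [e, h, Finset.prod_congr rfl (g := fun _ => mgf g (P.map (X (t / n))) l),
    Finset.prod_const, Finset.card_range]
  intro k _
  have hid : IdentDistrib (fun ω => g (X (gridPoint t n (k + 1)) ω - X (gridPoint t n k) ω))
      (fun ω => g (X (t / n) ω)) P P := by
    simp_rw [gridPoint_succ]
    exact (hX.stationary (gridPoint t n k) (t / n)).comp hg
  have h2 := mgf_congr_identDistrib hid
  rw [h2, mgf, mgf, integral_map (hX.measurable _).aemeasurable
    (((hg.const_mul l).exp).aestronglyMeasurable)]

/-- The increments telescope, so a grid sum of `g` is `X t` minus a grid sum of `y - g y`, which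
vanishes on `[-ε, ε]` and converges to a sum over jumps. The generating functions have the form `(1
+ a n / n) ^ n` with `a n` convergent. -/
theorem IsLevyProcess.mgf_sub_jumps {Ω : Type*} [MeasurableSpace Ω] {P : Measure Ω}
    [IsProbabilityMeasure P] {X : ℝ≥0 → Ω → ℝ} {γ b : ℝ} {ν : Measure ℝ}
    (hX : IsLevyProcess P X) (hT : HasTriplet P X γ b ν) (t : ℝ≥0)
    {g : ℝ → ℝ} (hg : Continuous g) {ε : ℝ} (hε : 0 < ε)
    (hgε : ∀ x, |x| ≤ ε → g x = x) {C : ℝ} (hC : ∀ x, |g x| ≤ C) (l : ℝ) :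
    AEMeasurable (fun ω => X t ω - ∑ᶠ s ∈ {s : ℝ≥0 | s ≤ t ∧ ε < |jump (fun r => X r ω) s|},
        (jump (fun r => X r ω) s - g (jump (fun r => X r ω) s))) P ∧
    Integrable (fun ω => Real.exp (l * (X t ω -
      ∑ᶠ s ∈ {s : ℝ≥0 | s ≤ t ∧ ε < |jump (fun r => X r ω) s|},
        (jump (fun r => X r ω) s - g (jump (fun r => X r ω) s))))) P ∧
    mgf (fun ω => X t ω - ∑ᶠ s ∈ {s : ℝ≥0 | s ≤ t ∧ ε < |jump (fun r => X r ω) s|},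
        (jump (fun r => X r ω) s - g (jump (fun r => X r ω) s))) P l =
      Real.exp (t * laplaceExponent γ b ν g l) := by
  set S : ℕ → Ω → ℝ := fun n ω => ∑ k ∈ Finset.range n,
    g (X (gridPoint t n (k + 1)) ω - X (gridPoint t n k) ω) with hSdef
  have hmeas : ∀ n, Measurable (S n) := fun n => Finset.measurable_sum _ fun k _ =>
    hg.measurable.comp ((hX.measurable _).sub (hX.measurable _))
  have hlim : ∀ᵐ ω ∂P, Tendsto (fun n => S n ω) atTop (𝓝 (X t ω -
      ∑ᶠ s ∈ {s : ℝ≥0 | s ≤ t ∧ ε < |jump (fun r => X r ω) s|},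
        (jump (fun r => X r ω) s - g (jump (fun r => X r ω) s)))) := by
    filter_upwards [hX.zero, hX.cadlag] with ω h0 hc
    have h := hc.tendsto_sum_increments t hε (f := fun y => y - g y) (by fun_prop)
      (fun y hy => by rw [hgε y hy, sub_self])
    refine (h.const_sub (X t ω)).congr' ?_
    filter_upwards [eventually_ne_atTop 0] with n hn
    rw [Finset.sum_sub_distrib, Finset.sum_range_sub (fun k => X (gridPoint t n k) ω),
      gridPoint_self t hn, gridPoint_zero, h0]
    simp only [hSdef]
    ring
  have hb : ∀ n ω, |S n ω| ≤ n * C := fun n ω => by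
    refine (Finset.abs_sum_le_sum_abs _ _).trans ?_
    refine (Finset.sum_le_sum fun k _ => hC _).trans ?_
    simp
  refine ⟨aemeasurable_of_tendsto_metrizable_ae _ (fun n => (hmeas n).aemeasurable) hlim, ?_⟩
  refine mgf_eq_of_tendsto (M := fun l => Real.exp (t * laplaceExponent γ b ν g l))
    (fun n => (hmeas n).aemeasurable) hlim
    (fun n l => integrable_exp_mul_of_bounded (hmeas n).aemeasurable (hb n) l) ?_ l
  intro l
  have hA := (hX.isInfinitesimalArray hT t).tendsto_mgf t.2 hT.levyMeasure hg hε hgε hC l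
  have := Real.tendsto_one_add_pow_exp_of_tendsto hA
  refine this.congr fun n => ?_
  rw [hX.mgf_sum_increments t hg.measurable]
  simp

/-! ### From soft to sharp cut-off at `ε`. -/

/-- A continuous approximation of `x 1_{|x| ≤ ε}`. -/
noncomputable def softCut (ε : ℝ) (m : ℕ) (x : ℝ) : ℝ :=
  x * max 0 (min 1 (1 - m * (|x| - ε)))

theorem continuous_softCut (ε : ℝ) (m : ℕ) : Continuous (softCut ε m) := by
  unfold softCut
  fun_prop

theorem softCut_eq_self {ε : ℝ} (m : ℕ) {x : ℝ} (hx : |x| ≤ ε) : softCut ε m x = x := by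
  have : (m : ℝ) * (|x| - ε) ≤ 0 := mul_nonpos_of_nonneg_of_nonpos m.cast_nonneg (by linarith)
  rw [softCut, min_eq_left (by linarith), max_eq_right zero_le_one, mul_one]

theorem softCut_eq_zero {ε : ℝ} {m : ℕ} {x : ℝ} (hx : 1 ≤ m * (|x| - ε)) : softCut ε m x = 0 := by
  rw [softCut, max_eq_left ((min_le_right _ _).trans (by linarith)), mul_zero]

/-- For `m = 0` the soft cut is the identity, which is unbounded; hence the index `m + 1` in what
follows. -/
theorem abs_softCut_le {ε : ℝ} (hε : 0 ≤ ε) {m : ℕ} (hm : 1 ≤ m) (x : ℝ) :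
    |softCut ε m x| ≤ ε + 1 := by
  have hm' : (1 : ℝ) ≤ m := by exact_mod_cast hm
  rcases le_or_gt |x| (ε + 1) with h | h
  · rw [softCut, abs_mul, abs_of_nonneg (a := max 0 (min 1 (1 - m * (|x| - ε)))) (le_max_left _ _)]
    exact (mul_le_of_le_one_right (abs_nonneg x)
      (max_le zero_le_one (min_le_left _ _))).trans h
  · rw [softCut_eq_zero (by nlinarith), abs_zero]
    linarith

theorem eventually_softCut_eq (ε x : ℝ) :
    ∀ᶠ m in atTop, softCut ε m x = Set.indicator {y : ℝ | |y| ≤ ε} (fun y => y) x := by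
  by_cases hx : x ∈ {y : ℝ | |y| ≤ ε}
  · rw [Set.indicator_of_mem hx]
    exact Eventually.of_forall fun m => softCut_eq_self m hx
  · rw [Set.indicator_of_notMem hx]
    have hx' : 0 < |x| - ε := sub_pos.2 (not_le.1 hx)
    filter_upwards [eventually_ge_atTop ⌈1 / (|x| - ε)⌉₊] with m hm
    apply softCut_eq_zero
    rw [← div_le_iff₀ hx']
    exact Nat.ceil_le.1 hm

theorem abs_exp_sub_one_sub_le (y : ℝ) : |Real.exp y - 1 - y| ≤ y ^ 2 * Real.exp |y| := by
  have h := Complex.norm_exp_sub_sum_le_norm_mul_exp (y : ℂ) 2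
  simp only [Finset.sum_range_succ, Finset.sum_range_zero, pow_zero, pow_one, Nat.factorial,
    zero_add, Complex.norm_real, Real.norm_eq_abs, sq_abs] at h
  have e : Complex.exp y - ((1 : ℂ) / ((1 : ℕ) : ℂ) + (y : ℂ) / (((0 + 1) * 1 : ℕ) : ℂ)) =
      ((Real.exp y - 1 - y : ℝ) : ℂ) := by
    push_cast; ring
  simp only [zero_add, mul_one] at e h
  rw [e, Complex.norm_real, Real.norm_eq_abs] at h
  exact h

/-- The constant does not depend on `g`, so one integrable function dominates all the soft cuts. For
`|x| ≤ ε` the kernel is of second order; beyond, it is bounded while `min 1 (x ^ 2) ≥ ε ^ 2`. -/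
theorem abs_laplaceKernel_le {ε : ℝ} (hε : 0 < ε) (hε1 : ε ≤ 1) {g : ℝ → ℝ}
    (hgε : ∀ x, |x| ≤ ε → g x = x) (hC : ∀ x, |g x| ≤ ε + 1) (l x : ℝ) :
    |Real.exp (l * g x) - 1 - l * Set.indicator {y : ℝ | |y| ≤ 1} (fun y => y) x| ≤
      (l ^ 2 * Real.exp |l| + (Real.exp (|l| * (ε + 1)) + 1 + |l|) / ε ^ 2) * min 1 (x ^ 2) := by
  have hA : 0 ≤ l ^ 2 * Real.exp |l| := by positivity
  have hB : 0 ≤ Real.exp (|l| * (ε + 1)) + 1 + |l| := by positivity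
  rcases le_or_gt |x| ε with hx | hx
  · have hx1 : |x| ≤ 1 := hx.trans hε1
    have hx2 : x ^ 2 ≤ 1 := by rw [← sq_abs]; nlinarith [abs_nonneg x]
    rw [Set.indicator_of_mem (show x ∈ {y : ℝ | |y| ≤ 1} from hx1), hgε x hx, min_eq_right hx2]
    refine (abs_exp_sub_one_sub_le (l * x)).trans ?_
    have h1 : Real.exp |l * x| ≤ Real.exp |l| := by
      rw [abs_mul]
      exact Real.exp_le_exp.2 (mul_le_of_le_one_right (abs_nonneg l) hx1)
    calc (l * x) ^ 2 * Real.exp |l * x| ≤ (l * x) ^ 2 * Real.exp |l| := by gcongr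
      _ = l ^ 2 * Real.exp |l| * x ^ 2 := by ring
      _ ≤ _ := by
        gcongr
        exact le_add_of_nonneg_right (by positivity)
  · have hmin : ε ^ 2 ≤ min 1 (x ^ 2) := by
      refine le_min (by nlinarith) ?_
      rw [← sq_abs x]; gcongr
    have hind : |Set.indicator {y : ℝ | |y| ≤ 1} (fun y => y) x| ≤ 1 := by
      by_cases h : x ∈ {y : ℝ | |y| ≤ 1}
      · rw [Set.indicator_of_mem h]; exact h
      · rw [Set.indicator_of_notMem h]; simp
    have h1 : |Real.exp (l * g x) - 1 - l * Set.indicator {y : ℝ | |y| ≤ 1} (fun y => y) x| ≤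
        Real.exp (|l| * (ε + 1)) + 1 + |l| := by
      refine (abs_sub _ _).trans (add_le_add ((abs_sub _ _).trans ?_) ?_)
      · rw [Real.abs_exp, abs_one]
        gcongr ?_ + 1
        exact exp_mul_le_exp_abs_mul l (hC x)
      · rw [abs_mul]
        exact mul_le_of_le_one_right (abs_nonneg l) hind
    refine h1.trans ?_
    calc Real.exp (|l| * (ε + 1)) + 1 + |l|
        = (Real.exp (|l| * (ε + 1)) + 1 + |l|) / ε ^ 2 * ε ^ 2 := by field_simp
      _ ≤ (Real.exp (|l| * (ε + 1)) + 1 + |l|) / ε ^ 2 * min 1 (x ^ 2) := by gcongr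
      _ ≤ _ := by
        have : 0 ≤ min 1 (x ^ 2) := le_min zero_le_one (sq_nonneg x)
        gcongr
        exact le_add_of_nonneg_left hA

theorem measurable_laplaceKernel {g : ℝ → ℝ} (hg : Measurable g) (l : ℝ) :
    Measurable fun x =>
      Real.exp (l * g x) - 1 - l * Set.indicator {y : ℝ | |y| ≤ 1} (fun y => y) x := by
  refine Measurable.sub (by fun_prop) (Measurable.const_mul ?_ _)
  exact Measurable.indicator (by fun_prop) (measurableSet_abs_le 1)

theorem IsLevyMeasure.tendsto_laplaceExponent_softCut {ν : Measure ℝ} (hν : IsLevyMeasure ν)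
    (γ b : ℝ) {ε : ℝ} (hε : 0 < ε) (hε1 : ε ≤ 1) (l : ℝ) :
    Tendsto (fun m : ℕ => laplaceExponent γ b ν (softCut ε (m + 1)) l) atTop
      (𝓝 (laplaceExponent γ b ν (Set.indicator {y : ℝ | |y| ≤ ε} fun y => y) l)) := by
  refine Tendsto.const_add _ ?_
  refine tendsto_integral_of_dominated_convergence _ (fun m =>
    (measurable_laplaceKernel (continuous_softCut ε (m + 1)).measurable l).aestronglyMeasurable)
    (hν.integrable.const_mul
      (l ^ 2 * Real.exp |l| + (Real.exp (|l| * (ε + 1)) + 1 + |l|) / ε ^ 2)) ?_ ?_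
  · exact fun m => Eventually.of_forall fun x => abs_laplaceKernel_le hε hε1
      (fun x hx => softCut_eq_self _ hx) (abs_softCut_le hε.le (by omega)) l x
  · refine Eventually.of_forall fun x => tendsto_const_nhds.congr' ?_
    filter_upwards [(tendsto_add_atTop_nat 1).eventually (eventually_softCut_eq ε x)] with m hm
    rw [hm]

/-- The Laplace exponent of the compensated jumps of size at most `ε`. -/
noncomputable def smallJumpExponent (ν : Measure ℝ) (ε l : ℝ) : ℝ :=
  ∫ x in {x : ℝ | |x| ≤ ε}, (Real.exp (l * x) - 1 - l * x) ∂ν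

theorem IsLevyMeasure.integrableOn_sq {ν : Measure ℝ} (hν : IsLevyMeasure ν) {ε : ℝ}
    (hε1 : ε ≤ 1) : IntegrableOn (fun x : ℝ => x ^ 2) {x : ℝ | |x| ≤ ε} ν := by
  refine (hν.integrable.integrableOn).congr_fun (fun x hx => ?_) (measurableSet_abs_le ε)
  have h1 : |x| ≤ 1 := le_trans hx hε1
  refine min_eq_right ?_
  rw [← sq_abs]; nlinarith [abs_nonneg x]

theorem measurableSet_annulus (ε : ℝ) : MeasurableSet {x : ℝ | ε < |x| ∧ |x| ≤ 1} :=
  ((isOpen_lt continuous_const continuous_abs).measurableSet).inter (measurableSet_abs_le 1)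

theorem IsLevyMeasure.integrableOn_annulus {ν : Measure ℝ} (hν : IsLevyMeasure ν) {ε : ℝ}
    (hε : 0 < ε) (hε1 : ε ≤ 1) :
    IntegrableOn (fun x : ℝ => x) {x : ℝ | ε < |x| ∧ |x| ≤ 1} ν := by
  refine ((hν.integrable.const_mul (1 / ε ^ 2)).integrableOn).mono' (by fun_prop) ?_
  filter_upwards [ae_restrict_mem (measurableSet_annulus ε)] with x hx
  have hmin : ε ^ 2 ≤ min 1 (x ^ 2) := by
    refine le_min (by nlinarith) ?_
    rw [← sq_abs x]
    have := hx.1.le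
    gcongr
  calc ‖x‖ ≤ 1 := hx.2
    _ = 1 / ε ^ 2 * ε ^ 2 := by field_simp
    _ ≤ _ := by gcongr

/-- Where `|x| > ε` the exponential equals `1`, and only the compensator on `ε < |x| ≤ 1` remains.
-/
theorem IsLevyMeasure.laplaceExponent_indicator {ν : Measure ℝ} (hν : IsLevyMeasure ν)
    (γ b : ℝ) {ε : ℝ} (hε : 0 < ε) (hε1 : ε ≤ 1) (l : ℝ) :
    laplaceExponent γ b ν (Set.indicator {y : ℝ | |y| ≤ ε} fun y => y) l =
      l * γ + b ^ 2 * l ^ 2 / 2 + smallJumpExponent ν ε l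
        - l * ∫ x in {x : ℝ | ε < |x| ∧ |x| ≤ 1}, x ∂ν := by
  have hI : IntegrableOn (fun x : ℝ => Real.exp (l * x) - 1 - l * x) {x : ℝ | |x| ≤ ε} ν := by
    refine ((hν.integrableOn_sq hε1).const_mul (l ^ 2 * Real.exp |l|)).mono' (by fun_prop) ?_
    filter_upwards [ae_restrict_mem (measurableSet_abs_le ε)] with x hx
    refine (abs_exp_sub_one_sub_le (l * x)).trans ?_
    have h1 : Real.exp |l * x| ≤ Real.exp |l| := by
      rw [abs_mul]
      exact Real.exp_le_exp.2 (mul_le_of_le_one_right (abs_nonneg l) (le_trans hx hε1))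
    calc (l * x) ^ 2 * Real.exp |l * x| ≤ (l * x) ^ 2 * Real.exp |l| := by gcongr
      _ = l ^ 2 * Real.exp |l| * x ^ 2 := by ring
  have hJ : IntegrableOn (fun x : ℝ => l * x) {x : ℝ | ε < |x| ∧ |x| ≤ 1} ν :=
    (hν.integrableOn_annulus hε hε1).const_mul l
  rw [laplaceExponent, smallJumpExponent, add_sub_assoc, ← integral_const_mul,
    ← integral_indicator (measurableSet_abs_le ε), ← integral_indicator (measurableSet_annulus ε),
    ← integral_sub (hI.integrable_indicator (measurableSet_abs_le ε))
      (hJ.integrable_indicator (measurableSet_annulus ε))]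
  congr 1
  refine integral_congr_ae (Eventually.of_forall fun x => ?_)
  simp only [Set.indicator_apply, Set.mem_ofPred_eq]
  by_cases h1 : |x| ≤ ε
  · have h2 : ¬ (ε < |x| ∧ |x| ≤ 1) := fun h => absurd h.1 (not_lt.2 h1)
    rw [if_pos h1, if_pos (h1.trans hε1), if_neg h2, if_pos h1, sub_zero]
  · by_cases h3 : |x| ≤ 1
    · have h2 : ε < |x| ∧ |x| ≤ 1 := ⟨not_le.1 h1, h3⟩
      rw [if_neg h1, if_pos h3, if_pos h2, if_neg h1]
      simp
    · have h2 : ¬ (ε < |x| ∧ |x| ≤ 1) := fun h => h3 h.2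
      rw [if_neg h1, if_neg h3, if_neg h2, if_neg h1]
      simp

/-- The sum of the jumps larger than `ε` is a limit of sums of soft-thresholded jumps. -/
theorem IsCadlag.tendsto_finsum_softCut {x : ℝ≥0 → ℝ} (hx : IsCadlag x) (t : ℝ≥0) {ε : ℝ}
    (hε : 0 < ε) :
    Tendsto (fun m : ℕ => ∑ᶠ s ∈ {s : ℝ≥0 | s ≤ t ∧ ε < |jump x s|},
        (jump x s - softCut ε (m + 1) (jump x s))) atTop
      (𝓝 (∑ᶠ s ∈ {s : ℝ≥0 | s ≤ t ∧ ε < |jump x s|}, jump x s)) := by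
  have hfin := hx.finite_jumps t hε
  simp_rw [fun f : ℝ≥0 → ℝ => finsum_mem_eq_finite_toFinset_sum f hfin]
  refine tendsto_finsetSum _ fun s hs => tendsto_const_nhds.congr' ?_
  have hs' : ε < |jump x s| := ((Set.Finite.mem_toFinset hfin).1 hs).2
  filter_upwards [(tendsto_add_atTop_nat 1).eventually (eventually_softCut_eq ε (jump x s))]
    with m hm
  rw [hm, Set.indicator_of_notMem (by simpa using hs'), sub_zero]

/-- The sharp cut-off is discontinuous and cannot be applied to the increments, so it is reached by
a second limit, along the soft cuts. -/
theorem IsLevyProcess.mgf_sub_large_jumps {Ω : Type*} [MeasurableSpace Ω] {P : Measure Ω}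
    [IsProbabilityMeasure P] {X : ℝ≥0 → Ω → ℝ} {γ b : ℝ} {ν : Measure ℝ}
    (hX : IsLevyProcess P X) (hT : HasTriplet P X γ b ν) (t : ℝ≥0) {ε : ℝ} (hε : 0 < ε)
    (hε1 : ε ≤ 1) (l : ℝ) :
    mgf (fun ω => X t ω - ∑ᶠ s ∈ {s : ℝ≥0 | s ≤ t ∧ ε < |jump (fun r => X r ω) s|},
        jump (fun r => X r ω) s) P l =
      Real.exp (t * (l * γ + b ^ 2 * l ^ 2 / 2 + smallJumpExponent ν ε l
        - l * ∫ x in {x : ℝ | ε < |x| ∧ |x| ≤ 1}, x ∂ν)) := by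
  have h := fun (m : ℕ) (l : ℝ) => hX.mgf_sub_jumps hT t (continuous_softCut ε (m + 1)) hε
    (fun x hx => softCut_eq_self _ hx) (abs_softCut_le hε.le (by omega)) l
  rw [← hT.levyMeasure.laplaceExponent_indicator γ b hε hε1]
  refine (mgf_eq_of_tendsto (M := fun l => Real.exp (t * laplaceExponent γ b ν
    (Set.indicator {y : ℝ | |y| ≤ ε} fun y => y) l))
    (fun m => (h m 0).1) ?_ (fun m l => (h m l).2.1) ?_ l).2
  · filter_upwards [hX.cadlag] with ω hc
    exact (hc.tendsto_finsum_softCut t hε).const_sub _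
  · intro l
    simp_rw [fun m => (h m l).2.2]
    exact (Real.continuous_exp.tendsto _).comp
      ((hT.levyMeasure.tendsto_laplaceExponent_softCut γ b hε hε1 l).const_mul _)

/-! ### Splitting off the Brownian component. -/

/-- A measurable functional on paths that agrees on càdlàg paths with
`x t` minus the sum of the jumps larger than `ε` before `t`. -/
noncomputable def pathFunctional (t : ℝ≥0) (ε : ℝ) (x : ℝ≥0 → ℝ) : ℝ :=
  x t - limsup (fun m : ℕ => limsup (fun n : ℕ => ∑ k ∈ Finset.range n,
    ((x (gridPoint t n (k + 1)) - x (gridPoint t n k)) -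
      softCut ε (m + 1) (x (gridPoint t n (k + 1)) - x (gridPoint t n k)))) atTop) atTop

/-- Only countably many coordinates enter, through iterated upper limits, whereas a sum over all
jump times is not visibly measurable for the product σ-algebra. This lets independence of the paths
of `B` and `X - b B` pass to the remainder. -/
theorem measurable_pathFunctional (t : ℝ≥0) (ε : ℝ) : Measurable (pathFunctional t ε) := by
  refine (measurable_pi_apply t).sub (Measurable.limsup fun m => Measurable.limsup fun n =>
    Finset.measurable_fun_sum _ fun k _ => ?_)
  have h : Measurable fun x : ℝ≥0 → ℝ => x (gridPoint t n (k + 1)) - x (gridPoint t n k) :=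
    (measurable_pi_apply _).sub (measurable_pi_apply _)
  exact h.sub ((continuous_softCut ε (m + 1)).measurable.comp h)

theorem IsCadlag.pathFunctional_eq {x : ℝ≥0 → ℝ} (hx : IsCadlag x) (t : ℝ≥0) {ε : ℝ}
    (hε : 0 < ε) :
    pathFunctional t ε x = x t - ∑ᶠ s ∈ {s : ℝ≥0 | s ≤ t ∧ ε < |jump x s|}, jump x s := by
  have h1 := fun m : ℕ => (hx.tendsto_sum_increments t hε
    (f := fun y => y - softCut ε (m + 1) y)
    (continuous_id.sub (continuous_softCut ε (m + 1)))
    (fun y hy => by rw [softCut_eq_self _ hy, sub_self])).limsup_eq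
  rw [pathFunctional]
  simp_rw [h1]
  rw [(hx.tendsto_finsum_softCut t hε).limsup_eq]

theorem IsCadlag.sub_continuous {x y : ℝ≥0 → ℝ} (hx : IsCadlag x) (hy : Continuous y) :
    IsCadlag (fun s => x s - y s) := fun t =>
  ⟨(hx t).1.sub hy.continuousWithinAt, by
    obtain ⟨l, hl⟩ := (hx t).2
    exact ⟨l - y t, hl.sub ((hy.tendsto t).mono_left nhdsWithin_le_nhds)⟩⟩

theorem IsCadlag.jump_sub_continuous {x y : ℝ≥0 → ℝ} (hx : IsCadlag x) (hy : Continuous y)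
    (s : ℝ≥0) : jump (fun r => x r - y r) s = jump x s := by
  rcases eq_or_neBot (𝓝[<] s) with h | h
  · rw [jump_eq_zero_of_eq_bot h, jump_eq_zero_of_eq_bot h]
  · have := tendsto_nhds_unique ((hx.sub_continuous hy).tendsto_leftLim s)
      ((hx.tendsto_leftLim s).sub ((hy.tendsto s).mono_left nhdsWithin_le_nhds))
    rw [jump, jump, this]
    ring

/-- By convention `mgf` is `0` when the exponential is not integrable, so a positive value certifies
integrability. -/
theorem integrable_exp_mul_of_mgf_pos {Ω : Type*} [MeasurableSpace Ω] {P : Measure Ω} {Z : Ω → ℝ}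
    {l : ℝ} (h : 0 < mgf Z P l) : Integrable (fun ω => Real.exp (l * Z ω)) P := by
  by_contra hcon
  exact h.ne' (mgf_undef hcon)

theorem aemeasurable_of_mgf_pos {Ω : Type*} [MeasurableSpace Ω] {P : Measure Ω} {Z : Ω → ℝ}
    (h : ∀ l, 0 < mgf Z P l) : AEMeasurable Z P :=
  aemeasurable_of_integrable_exp_mul zero_ne_one (integrable_exp_mul_of_mgf_pos (h 0))
    (integrable_exp_mul_of_mgf_pos (h 1))

/-- The Laplace transform of the remainder. -/
theorem mgf_remainder {Ω : Type*} [MeasurableSpace Ω] {P : Measure Ω}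
    [IsProbabilityMeasure P] {X B : ℝ≥0 → Ω → ℝ} {γ b : ℝ} {ν : Measure ℝ}
    (hX : IsLevyProcess P X) (hT : HasTriplet P X γ b ν) (hB : IsBrownianComponent P X b B)
    (t : ℝ≥0) {ε : ℝ} (hε : 0 < ε) (hε1 : ε ≤ 1) (l : ℝ) :
    mgf (remainder X γ b B ν ε t) P l = Real.exp (t * smallJumpExponent ν ε l) := by
  set c := ∫ x in {x : ℝ | ε < |x| ∧ |x| ≤ 1}, x ∂ν with hc
  set V : Ω → ℝ := fun ω => X t ω -
    ∑ᶠ s ∈ {s : ℝ≥0 | s ≤ t ∧ ε < |jump (fun r => X r ω) s|}, jump (fun r => X r ω) s with hV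
  have hmV : ∀ l, mgf V P l = Real.exp (t * (l * γ + b ^ 2 * l ^ 2 / 2 + smallJumpExponent ν ε l
      - l * c)) := hX.mgf_sub_large_jumps hT t hε hε1
  -- The last factor is the generating function of `b B_t`.
  have hmVc : ∀ l, mgf (fun ω => V ω + (t * c - γ * t)) P l =
      Real.exp (t * smallJumpExponent ν ε l) * Real.exp (t * (b * l) ^ 2 / 2) := by
    intro l
    rw [mgf_add_const, hmV, ← Real.exp_add, ← Real.exp_add]
    congr 1
    ring
  have hrem : ∀ ω, remainder X γ b B ν ε t ω = V ω + (t * c - γ * t) - b * B t ω := by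
    intro ω
    simp only [remainder, truncated, hV, hc]
    ring
  rcases eq_or_ne b 0 with hb | hb
  · have : remainder X γ b B ν ε t = fun ω => V ω + (t * c - γ * t) := by
      funext ω
      rw [hrem, hb]; ring
    rw [this, hmVc, hb]
    simp
  · obtain ⟨hBr, hind⟩ := hB hb
    have hVm : AEMeasurable V P := aemeasurable_of_mgf_pos fun l => by rw [hmV]; positivity
    have hBm : AEMeasurable (B t) P := hBr.aemeasurable t
    have hRm : AEMeasurable (remainder X γ b B ν ε t) P := by
      rw [show remainder X γ b B ν ε t = fun ω => V ω + (t * c - γ * t) - b * B t ω from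
        funext hrem]
      exact (hVm.add_const _).sub (hBm.const_mul b)
    -- Brownian paths are continuous, so `X - b B` has the same jumps as `X` and determines the
    -- remainder.
    have hRae : (fun ω => pathFunctional t ε (fun s => X s ω - b * B s ω) + (t * c - γ * t)) =ᵐ[P]
        remainder X γ b B ν ε t := by
      filter_upwards [hX.cadlag, hBr.cont] with ω h1 h2
      have h3 : Continuous fun s => b * B s ω := continuous_const.mul h2
      rw [hrem, (h1.sub_continuous h3).pathFunctional_eq t hε]
      simp_rw [h1.jump_sub_continuous h3]
      simp only [hV]
      ring
    have hI : IndepFun (remainder X γ b B ν ε t) (fun ω => b * B t ω) P := by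
      have h := hind.symm.comp
        (φ := fun x : ℝ≥0 → ℝ => pathFunctional t ε x + (t * c - γ * t))
        (ψ := fun x : ℝ≥0 → ℝ => b * x t)
        ((measurable_pathFunctional t ε).add_const _) (by fun_prop)
      exact h.congr hRae (Eventually.of_forall fun _ => rfl)
    have hadd := hI.mgf_add' (t := l) hRm.aestronglyMeasurable (hBm.const_mul b).aestronglyMeasurable
    have hsum : remainder X γ b B ν ε t + (fun ω => b * B t ω) =
        fun ω => V ω + (t * c - γ * t) := by
      funext ω
      rw [Pi.add_apply, hrem]
      ring
    rw [hsum, hmVc, mgf_const_mul, mgf_gaussianReal (hBr.hasLaw_eval t).map_eq, zero_mul,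
      zero_add] at hadd
    exact (mul_right_cancel₀ (Real.exp_pos _).ne' hadd).symm

/-! ### Derivatives of the Laplace exponent and the fourth moment. -/

/-- Differentiation under the integral over `{|x| ≤ ε}` when the derivative is `O(x²)`. -/
theorem IsLevyMeasure.hasDerivAt_setIntegral {ν : Measure ℝ} (hν : IsLevyMeasure ν) {ε : ℝ}
    (hε1 : ε ≤ 1) {F F' : ℝ → ℝ → ℝ} (hF : ∀ l, Continuous (F l)) (hF' : ∀ l, Continuous (F' l))
    (hderiv : ∀ l x, HasDerivAt (fun l => F l x) (F' l x) l) {C C' : ℝ → ℝ}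
    (hC : ∀ l x, |x| ≤ 1 → |F l x| ≤ C l * x ^ 2)
    (hC' : ∀ r l x, |l| ≤ r → |x| ≤ 1 → |F' l x| ≤ C' r * x ^ 2) (l : ℝ) :
    HasDerivAt (fun l => ∫ x in {x : ℝ | |x| ≤ ε}, F l x ∂ν)
      (∫ x in {x : ℝ | |x| ≤ ε}, F' l x ∂ν) l := by
  have hsq := hν.integrableOn_sq hε1
  refine (hasDerivAt_integral_of_dominated_loc_of_deriv_le (Metric.ball_mem_nhds l one_pos)
    (Eventually.of_forall fun l => (hF l).aestronglyMeasurable)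
    ((hsq.const_mul (C l)).mono' (hF l).aestronglyMeasurable ?_) (hF' l).aestronglyMeasurable
    (bound := fun x => C' (|l| + 1) * x ^ 2) ?_ (hsq.const_mul _) ?_).2
  · filter_upwards [ae_restrict_mem (measurableSet_abs_le ε)] with x hx
    exact hC l x (le_trans hx hε1)
  · filter_upwards [ae_restrict_mem (measurableSet_abs_le ε)] with x hx m hm
    refine hC' _ m x ?_ (le_trans hx hε1)
    have h1 : |m - l| < 1 := hm
    have h2 := abs_add_le (m - l) l
    rw [sub_add_cancel] at h2
    linarith
  · exact Eventually.of_forall fun x m _ => hderiv m x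

/-- The integrals `∫_{|x| ≤ ε} x^j exp (l x) ν(dx)`. -/
noncomputable def smallJumpMoment (ν : Measure ℝ) (ε : ℝ) (j : ℕ) (l : ℝ) : ℝ :=
  ∫ x in {x : ℝ | |x| ≤ ε}, x ^ j * Real.exp (l * x) ∂ν

/-- The integral `∫_{|x| ≤ ε} x (exp (l x) - 1) ν(dx)`. -/
noncomputable def smallJumpDrift (ν : Measure ℝ) (ε : ℝ) (l : ℝ) : ℝ :=
  ∫ x in {x : ℝ | |x| ≤ ε}, x * (Real.exp (l * x) - 1) ∂ν

theorem abs_pow_mul_exp_le {j : ℕ} (hj : 2 ≤ j) {r l x : ℝ} (hl : |l| ≤ r) (hx : |x| ≤ 1) :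
    |x ^ j * Real.exp (l * x)| ≤ Real.exp r * x ^ 2 := by
  have h1 : |x ^ j| ≤ x ^ 2 := by
    rw [abs_pow, ← sq_abs x]
    exact pow_le_pow_of_le_one (abs_nonneg x) hx hj
  have h2 : Real.exp (l * x) ≤ Real.exp r := by
    refine Real.exp_le_exp.2 ((le_abs_self _).trans ?_)
    rw [abs_mul]
    exact (mul_le_of_le_one_right (abs_nonneg l) hx).trans hl
  rw [abs_mul, Real.abs_exp, mul_comm]
  gcongr

theorem abs_exp_sub_one_le_mul_exp (y : ℝ) : |Real.exp y - 1| ≤ |y| * Real.exp |y| := by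
  have h := norm_exp_sub_one_le_mul_exp (y : ℂ)
  rw [← Complex.ofReal_exp, ← Complex.ofReal_one, ← Complex.ofReal_sub, Complex.norm_real,
    Complex.norm_real] at h
  exact h

theorem exp_abs_mul_le {r l x : ℝ} (hl : |l| ≤ r) (hx : |x| ≤ 1) :
    Real.exp |l * x| ≤ Real.exp r := by
  refine Real.exp_le_exp.2 ?_
  rw [abs_mul]
  exact (mul_le_of_le_one_right (abs_nonneg l) hx).trans hl

theorem abs_mul_exp_sub_one_le {r l x : ℝ} (hl : |l| ≤ r) (hx : |x| ≤ 1) :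
    |x * (Real.exp (l * x) - 1)| ≤ r * Real.exp r * x ^ 2 := by
  have hr : 0 ≤ r := (abs_nonneg l).trans hl
  rw [abs_mul]
  calc |x| * |Real.exp (l * x) - 1| ≤ |x| * (|l * x| * Real.exp |l * x|) := by
        gcongr; exact abs_exp_sub_one_le_mul_exp _
    _ = |l| * Real.exp |l * x| * x ^ 2 := by rw [abs_mul l x, ← sq_abs x]; ring
    _ ≤ r * Real.exp r * x ^ 2 := by
        gcongr ?_ * ?_ * x ^ 2
        exact exp_abs_mul_le hl hx

theorem IsLevyMeasure.hasDerivAt_smallJumpMoment {ν : Measure ℝ} (hν : IsLevyMeasure ν) {ε : ℝ}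
    (hε1 : ε ≤ 1) {j : ℕ} (hj : 2 ≤ j) (l : ℝ) :
    HasDerivAt (smallJumpMoment ν ε j) (smallJumpMoment ν ε (j + 1) l) l := by
  refine hν.hasDerivAt_setIntegral hε1 (F := fun l x => x ^ j * Real.exp (l * x))
    (F' := fun l x => x ^ (j + 1) * Real.exp (l * x)) (C := fun l => Real.exp |l|)
    (C' := fun r => Real.exp r) (fun l => by fun_prop) (fun l => by fun_prop) ?_
    (fun l x hx => abs_pow_mul_exp_le hj le_rfl hx)
    (fun r l x hl hx => abs_pow_mul_exp_le (by omega) hl hx) l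
  intro l x
  have := (((hasDerivAt_id l).mul_const x).exp).const_mul (x ^ j)
  convert! this using 1
  simp only [id]
  ring

theorem IsLevyMeasure.hasDerivAt_smallJumpDrift {ν : Measure ℝ} (hν : IsLevyMeasure ν) {ε : ℝ}
    (hε1 : ε ≤ 1) (l : ℝ) :
    HasDerivAt (smallJumpDrift ν ε) (smallJumpMoment ν ε 2 l) l := by
  refine hν.hasDerivAt_setIntegral hε1 (F := fun l x => x * (Real.exp (l * x) - 1))
    (F' := fun l x => x ^ 2 * Real.exp (l * x)) (C := fun l => |l| * Real.exp |l|)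
    (C' := fun r => Real.exp r) (fun l => by fun_prop) (fun l => by fun_prop) ?_
    (fun l x hx => abs_mul_exp_sub_one_le le_rfl hx)
    (fun r l x hl hx => abs_pow_mul_exp_le le_rfl hl hx) l
  intro l x
  have := ((((hasDerivAt_id l).mul_const x).exp).sub_const 1).const_mul x
  convert! this using 1
  simp only [id]
  ring

theorem IsLevyMeasure.hasDerivAt_smallJumpExponent {ν : Measure ℝ} (hν : IsLevyMeasure ν) {ε : ℝ}
    (hε1 : ε ≤ 1) (l : ℝ) :
    HasDerivAt (smallJumpExponent ν ε) (smallJumpDrift ν ε l) l := by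
  refine hν.hasDerivAt_setIntegral hε1 (F := fun l x => Real.exp (l * x) - 1 - l * x)
    (F' := fun l x => x * (Real.exp (l * x) - 1)) (C := fun l => |l| ^ 2 * Real.exp |l|)
    (C' := fun r => r * Real.exp r) (fun l => by fun_prop) (fun l => by fun_prop) ?_ ?_
    (fun r l x hl hx => abs_mul_exp_sub_one_le hl hx) l
  · intro l x
    have := ((((hasDerivAt_id l).mul_const x).exp).sub_const 1).sub
      ((hasDerivAt_id l).mul_const x)
    convert! this using 1
    simp only [id]
    ring
  · intro l x hx
    refine (abs_exp_sub_one_sub_le _).trans ?_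
    calc (l * x) ^ 2 * Real.exp |l * x| ≤ (l * x) ^ 2 * Real.exp |l| := by
          exact mul_le_mul_of_nonneg_left (exp_abs_mul_le le_rfl hx) (sq_nonneg _)
      _ = |l| ^ 2 * Real.exp |l| * x ^ 2 := by rw [sq_abs]; ring

/-- The fourth derivative at `0` of the Laplace transform of the small jumps. -/
theorem IsLevyMeasure.iteratedDeriv_four_exp_smallJumpExponent {ν : Measure ℝ}
    (hν : IsLevyMeasure ν) {ε : ℝ} (hε1 : ε ≤ 1) (t : ℝ) :
    iteratedDeriv 4 (fun l => Real.exp (t * smallJumpExponent ν ε l)) 0 =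
      t * (∫ x in {x : ℝ | |x| ≤ ε}, x ^ 4 ∂ν)
        + 3 * (t * ∫ x in {x : ℝ | |x| ≤ ε}, x ^ 2 ∂ν) ^ 2 := by
  set M : ℝ → ℝ := fun l => Real.exp (t * smallJumpExponent ν ε l) with hM
  set d := smallJumpDrift ν ε with hd
  set m2 := smallJumpMoment ν ε 2
  set m3 := smallJumpMoment ν ε 3
  set m4 := smallJumpMoment ν ε 4
  have hd1 : ∀ l, HasDerivAt d (m2 l) l := hν.hasDerivAt_smallJumpDrift hε1
  have h2 : ∀ l, HasDerivAt m2 (m3 l) l := hν.hasDerivAt_smallJumpMoment hε1 le_rfl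
  have h3 : ∀ l, HasDerivAt m3 (m4 l) l := hν.hasDerivAt_smallJumpMoment hε1 (by norm_num)
  have hM1 : ∀ l, HasDerivAt M (t * d l * M l) l := fun l => by
    have := ((hν.hasDerivAt_smallJumpExponent hε1 l).const_mul t).exp
    convert! this using 1
    simp only [hM, hd]
    ring
  have e1 : deriv M = fun l => t * d l * M l := funext fun l => (hM1 l).deriv
  have e2 : deriv (fun l => t * d l * M l) = fun l => (t * m2 l + (t * d l) ^ 2) * M l :=
    funext fun l => by
      rw [(((hd1 l).const_mul t).fun_mul (hM1 l)).deriv]; ring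
  have e3 : deriv (fun l => (t * m2 l + (t * d l) ^ 2) * M l) =
      fun l => (t * m3 l + 3 * (t * d l) * (t * m2 l) + (t * d l) ^ 3) * M l :=
    funext fun l => by
      rw [((((h2 l).const_mul t).fun_add (((hd1 l).const_mul t).fun_pow 2)).fun_mul (hM1 l)).deriv]
      ring
  -- The fourth complete Bell polynomial in the derivatives of `t ψ`. Compensation makes `d 0 = 0`,
  -- which leaves only `t * m4 0 + 3 * (t * m2 0) ^ 2`.
  have e4 : deriv (fun l => (t * m3 l + 3 * (t * d l) * (t * m2 l) + (t * d l) ^ 3) * M l) 0 =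
      (t * m4 0 + 3 * (t * m2 0) ^ 2 + 4 * (t * d 0) * (t * m3 0)
        + 6 * (t * d 0) ^ 2 * (t * m2 0) + (t * d 0) ^ 4) * M 0 := by
    rw [(((((h3 0).const_mul t).fun_add ((((hd1 0).const_mul t).const_mul 3).fun_mul
      ((h2 0).const_mul t))).fun_add (((hd1 0).const_mul t).fun_pow 3)).fun_mul (hM1 0)).deriv]
    ring
  rw [iteratedDeriv_succ, iteratedDeriv_succ, iteratedDeriv_succ, iteratedDeriv_one, e1, e2, e3, e4]
  have z0 : M 0 = 1 := by simp [hM, smallJumpExponent]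
  have z1 : d 0 = 0 := by simp [hd, smallJumpDrift]
  have z2 : m2 0 = ∫ x in {x : ℝ | |x| ≤ ε}, x ^ 2 ∂ν := by simp [m2, smallJumpMoment]
  have z4 : m4 0 = ∫ x in {x : ℝ | |x| ≤ ε}, x ^ 4 ∂ν := by simp [m4, smallJumpMoment]
  rw [z0, z1, z2, z4]
  ring

/-! ### The scale `σ₀(ε)` and the conclusion. -/

theorem sigma_sq (ν : Measure ℝ) (ε : ℝ) :
    sigma ν ε ^ 2 = ∫ x in {x : ℝ | |x| ≤ ε}, x ^ 2 ∂ν :=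
  Real.sq_sqrt (integral_nonneg fun x => sq_nonneg x)

/-- Both parts of the maximum `σ₀` are needed: `ε ≤ σ₀` gives `|l x| ≤ 1`, hence `exp (l x) - 1 - l
x ≤ (l x)²`, and `σ ≤ σ₀` bounds the resulting integral `l² σ²`. -/
theorem IsLevyMeasure.smallJumpExponent_le_one {ν : Measure ℝ} (hν : IsLevyMeasure ν) {ε : ℝ}
    (hε : 0 < ε) (hε1 : ε ≤ 1) {l : ℝ} (hl : |l| = (sigma0 ν ε)⁻¹) :
    smallJumpExponent ν ε l ≤ 1 := by
  have h0 : 0 < sigma0 ν ε := lt_max_of_lt_right hε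
  have hεs : ε ≤ sigma0 ν ε := le_max_right _ _
  calc smallJumpExponent ν ε l ≤ ∫ x in {x : ℝ | |x| ≤ ε}, l ^ 2 * x ^ 2 ∂ν := by
        refine integral_mono_of_nonneg (Eventually.of_forall fun x => ?_)
          ((hν.integrableOn_sq hε1).const_mul _) ?_
        · have := Real.add_one_le_exp (l * x)
          simp only [Pi.zero_apply]
          linarith
        · filter_upwards [ae_restrict_mem (measurableSet_abs_le ε)] with x hx
          have hx' : |x| ≤ ε := hx
          have h1 : |l * x| ≤ 1 := by
            rw [abs_mul, hl, inv_mul_le_one₀ h0]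
            exact hx'.trans hεs
          have := Real.abs_exp_sub_one_sub_id_le h1
          rw [mul_pow] at this
          exact (le_abs_self _).trans this
    _ = (sigma ν ε / sigma0 ν ε) ^ 2 := by
        rw [integral_const_mul, ← sigma_sq, ← sq_abs l, hl]
        field_simp
    _ ≤ 1 := by
        have h1 : 0 ≤ sigma ν ε := Real.sqrt_nonneg _
        have h2 : sigma ν ε / sigma0 ν ε ≤ 1 := (div_le_one h0).2 (le_max_left _ _)
        have h3 : 0 ≤ sigma ν ε / sigma0 ν ε := by positivity
        nlinarith

end SmallJumps

theorem proposition1 :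
    (∀ (Ω : Type u) [MeasurableSpace Ω] (P : Measure Ω) [IsProbabilityMeasure P]
      (X B : ℝ≥0 → Ω → ℝ) (γ b : ℝ) (ν : Measure ℝ) (ε : ℝ) (t : ℝ≥0),
      0 ≤ b → SmallJumps.IsLevyProcess P X → SmallJumps.HasTriplet P X γ b ν →
      SmallJumps.IsBrownianComponent P X b B → 0 < ε → ε ≤ 1 →
      Integrable (fun ω => |SmallJumps.remainder X γ b B ν ε t ω| ^ 4) P ∧
      ∫ ω, |SmallJumps.remainder X γ b B ν ε t ω| ^ 4 ∂P =
        t * (∫ x in {x : ℝ | |x| ≤ ε}, x ^ 4 ∂ν) + 3 * (t * SmallJumps.sigma ν ε ^ 2) ^ 2) ∧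
    (∀ (q : ℝ) (t : ℝ≥0), 0 < q → ∃ K : ℝ, 0 < K ∧
      ∀ (Ω : Type u) [MeasurableSpace Ω] (P : Measure Ω) [IsProbabilityMeasure P]
        (X B : ℝ≥0 → Ω → ℝ) (γ b : ℝ) (ν : Measure ℝ) (ε : ℝ),
        0 ≤ b → SmallJumps.IsLevyProcess P X → SmallJumps.HasTriplet P X γ b ν →
        SmallJumps.IsBrownianComponent P X b B → 0 < ε → ε ≤ 1 →
        Integrable (fun ω => |SmallJumps.remainder X γ b B ν ε t ω| ^ q) P ∧
        ∫ ω, |SmallJumps.remainder X γ b B ν ε t ω| ^ q ∂P ≤ K * SmallJumps.sigma0 ν ε ^ q) := by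
  refine ⟨?_, ?_⟩
  · intro Ω _ P _ X B γ b ν ε t _ hX hT hB hε hε1
    have hmgf := SmallJumps.mgf_remainder hX hT hB t hε hε1
    have hint : ∀ l, Integrable
        (fun ω => Real.exp (l * SmallJumps.remainder X γ b B ν ε t ω)) P := fun l =>
      SmallJumps.integrable_exp_mul_of_mgf_pos (by rw [hmgf]; positivity)
    refine ⟨integrable_pow_abs_of_integrable_exp_mul one_ne_zero (hint 1) (hint (-1)) 4, ?_⟩
    have h0 : (0 : ℝ) ∈ interior (integrableExpSet (SmallJumps.remainder X γ b B ν ε t) P) := by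
      rw [show integrableExpSet (SmallJumps.remainder X γ b B ν ε t) P = Set.univ from
        Set.eq_univ_of_forall hint]
      simp
    have h4 := iteratedDeriv_mgf_zero h0 4
    rw [funext hmgf, hT.levyMeasure.iteratedDeriv_four_exp_smallJumpExponent hε1] at h4
    rw [SmallJumps.sigma_sq, h4]
    refine integral_congr_ae (Eventually.of_forall fun ω => ?_)
    simp only [Pi.pow_apply]
    exact (by decide : Even 4).pow_abs _
  · intro q t hq
    -- From `|r|^q ≤ (q / l)^q (exp (l r) + exp (-l r))` at `l = 1 / σ₀(ε)`: both exponential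
    -- moments are at most `exp t`, and `(q / l)^q = q^q σ₀(ε)^q`.
    refine ⟨q ^ q * (2 * Real.exp t), by positivity, ?_⟩
    intro Ω _ P _ X B γ b ν ε _ hX hT hB hε hε1
    have hmgf := SmallJumps.mgf_remainder hX hT hB t hε hε1
    have hint : ∀ l, Integrable
        (fun ω => Real.exp (l * SmallJumps.remainder X γ b B ν ε t ω)) P := fun l =>
      SmallJumps.integrable_exp_mul_of_mgf_pos (by rw [hmgf]; positivity)
    refine ⟨integrable_rpow_abs_of_integrable_exp_mul one_ne_zero (hint 1) (hint (-1)) hq.le, ?_⟩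
    have h0 : 0 < SmallJumps.sigma0 ν ε := lt_max_of_lt_right hε
    set l := (SmallJumps.sigma0 ν ε)⁻¹ with hl
    have hlpos : 0 < l := inv_pos.2 h0
    have hle : ∀ m : ℝ, |m| = l → mgf (SmallJumps.remainder X γ b B ν ε t) P m ≤ Real.exp t := by
      intro m hm
      rw [hmgf]
      refine Real.exp_le_exp.2 (mul_le_of_le_one_right t.2 ?_)
      exact hT.levyMeasure.smallJumpExponent_le_one hε hε1 hm
    calc ∫ ω, |SmallJumps.remainder X γ b B ν ε t ω| ^ q ∂P
        ≤ ∫ ω, (q / |l|) ^ q * (Real.exp (l * SmallJumps.remainder X γ b B ν ε t ω)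
            + Real.exp (-l * SmallJumps.remainder X γ b B ν ε t ω)) ∂P := by
          refine integral_mono
            (integrable_rpow_abs_of_integrable_exp_mul one_ne_zero (hint 1) (hint (-1)) hq.le)
            (((hint l).add (hint (-l))).const_mul _) fun ω => ?_
          refine (rpow_abs_le_mul_max_exp _ hq.le hlpos.ne').trans ?_
          gcongr
          exact max_le_add_of_nonneg (Real.exp_pos _).le (Real.exp_pos _).le
      _ = (q / |l|) ^ q * (mgf (SmallJumps.remainder X γ b B ν ε t) P l
            + mgf (SmallJumps.remainder X γ b B ν ε t) P (-l)) := by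
          rw [integral_const_mul, integral_add (hint l) (hint (-l))]
          rfl
      _ ≤ (q / |l|) ^ q * (Real.exp t + Real.exp t) := by
          gcongr
          · exact hle l (abs_of_pos hlpos)
          · exact hle (-l) (by rw [abs_neg, abs_of_pos hlpos])
      _ = q ^ q * (2 * Real.exp t) * SmallJumps.sigma0 ν ε ^ q := by
          rw [abs_of_pos hlpos, hl, div_inv_eq_mul, Real.mul_rpow hq.le h0.le]
          ring
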